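/- Fix a function $\ell:\mathbb N\to\mathbb N$. The random oracle $\mathcal O$ answers each query $x\in\{0,1\}^*$ with a uniformly random string in $\{0,1\}^{\ell(|x|)}$, independently for distinct $x$ (and consistently for repeated $x$). An oracle signature scheme for $n$-bit messages (with perfect completeness) is a triple of always-halting, not necessarily efficient, oracle algorithms $(\mathsf{Gen},\mathsf{Sign},\mathsf{Ver})$, where $\mathsf{Gen}$ may toss coins (finitely many uniform bits) and $\mathsf{Sign},\mathsf{Ver}$ are deterministic, such that for every oracle $\mathcal O$, every outcome of the coins of $\mathsf{Gen}$ with resulting pair $(SK,VK)=\mathsf{Gen}^{\mathcal O}(1^n)$, and every $\alpha\in\{0,1\}^n$, $\mathsf{Ver}^{\mathcal O}(VK,\alpha,\mathsf{Sign}^{\mathcal O}(SK,\alpha))=1$. The scheme asks at most $q$ queries in total if for every oracle, all coins and every message $\alpha$, the total number of oracle queries made in generating the keys, signing $\alpha$, and verifying the resulting signature is at most $q$. For a message $\alpha$ and a (probabilistic, computationally unbounded) adversary $A$, the success probability is $$\Pr\big[\mathsf{Ver}^{\mathcal O}(VK,\alpha^*,\sigma^*)=1 \text{ and } \alpha^*\ne\alpha\big],\quad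 (SK,VK)=\mathsf{Gen}^{\mathcal O}(1^n),\ (\alpha^*,\sigma^*)=A^{\mathcal O}(VK,\mathsf{Sign}^{\mathcal O}(SK,\alpha)),$$ over the random oracle and the coins of $\mathsf{Gen}$ and $A$. For $S\in\mathbb N$, the scheme has one-time black-box security $S$ if for every $\alpha$, every integer $1\le T\le S$ and every $A$ making at most $T$ oracle queries, the success probability is at most $T/S$. **Theorem.** There are functions $\varepsilon,\eta:\mathbb N\to\mathbb R$ with $\varepsilon(q)\to0$ and $\eta(q)\to0$ as $q\to\infty$ such that for every $\ell$, all integers $1\le q\le n$, and every oracle signature scheme for $n$-bit messages asking at most $q$ queries in total: 1. there are a message $\alpha\in\{0,1\}^n$ and an adversary making at most $2^{(1+\varepsilon(q))q}$ oracle queries whose success probability is at least $1-\eta(q)$ and also at least $0.49$; 2. if the scheme has one-time black-box security $S$, then $S\le 2^{(1+\varepsilon(q))q}$. -/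

import Mathlib

open MeasureTheory Filter Topology

namespace OneTimeSig

/-- Bit strings of length `k`. -/
abbrev Bits (k : ℕ) : Type := Fin k → Bool

/-- An oracle: a query is a bit string `x` of any length `k`, and the answer is a bit string of
length `ℓ k`. -/
abbrev Oracle (ℓ : ℕ → ℕ) : Type := (x : List Bool) → Bits (ℓ x.length)

/-- A halting deterministic oracle algorithm, with its input fixed: either it returns a value, or
it makes an oracle query and continues depending on the answer. No computational restriction is
imposed. -/
inductive OracleComp (ℓ : ℕ → ℕ) (β : Type) : Type where
  | ret (b : β) : OracleComp ℓ β
  | query (x : List Bool) (next : Bits (ℓ x.length) → OracleComp ℓ β) : OracleComp ℓ β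

namespace OracleComp

variable {ℓ : ℕ → ℕ} {β : Type}

/-- The value returned when queries are answered by the oracle `O`. -/
def eval (O : Oracle ℓ) : OracleComp ℓ β → β
  | ret b => b
  | query x next => (next (O x)).eval O

/-- The number of queries made (with multiplicity) when queries are answered by `O`. -/
def queries (O : Oracle ℓ) : OracleComp ℓ β → ℕ
  | ret _ => 0
  | query x next => (next (O x)).queries O + 1

end OracleComp

/-- The uniform distribution on bit strings of length `k`. -/
noncomputable def uniformBits (k : ℕ) : Measure (Bits k) :=
  (PMF.uniformOfFintype (Bits k)).toMeasure

instance (k : ℕ) : IsProbabilityMeasure (uniformBits k) := by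
  unfold uniformBits; infer_instance

/-- The random oracle: the answers to distinct queries are independent and uniform. -/
noncomputable def randomOracle (ℓ : ℕ → ℕ) : Measure (Oracle ℓ) :=
  Measure.infinitePi fun x : List Bool => uniformBits (ℓ x.length)

/-- An oracle signature scheme with perfect completeness for `n`-bit messages. Key generation is
probabilistic: it reads a random tape of `coins` uniform bits. Signing and verification are
deterministic. -/
structure SignatureScheme (ℓ : ℕ → ℕ) (n : ℕ) (SK VK Sg : Type) where
  coins : ℕ
  gen : Bits coins → OracleComp ℓ (SK × VK)
  sign : SK → Bits n → OracleComp ℓ Sg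
  ver : VK → Bits n → Sg → OracleComp ℓ Bool
  complete : ∀ (O : Oracle ℓ) (ω : Bits coins) (α : Bits n),
    (ver ((gen ω).eval O).2 α ((sign ((gen ω).eval O).1 α).eval O)).eval O = true

/-- A probabilistic, computationally unbounded adversary: from `coins` uniform bits, a verification
key and a signature, it computes a message and a candidate signature on that message. -/
structure Adversary (ℓ : ℕ → ℕ) (n : ℕ) (VK Sg : Type) where
  coins : ℕ
  alg : Bits coins → VK → Sg → OracleComp ℓ (Bits n × Sg)

/-- The adversary makes at most `T` oracle queries, whatever its input, coins and oracle. -/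
def Adversary.MakesAtMost {ℓ : ℕ → ℕ} {n : ℕ} {VK Sg : Type} (A : Adversary ℓ n VK Sg)
    (T : ℕ) : Prop :=
  ∀ (O : Oracle ℓ) (ω : Bits A.coins) (vk : VK) (σ : Sg), (A.alg ω vk σ).queries O ≤ T

namespace SignatureScheme

variable {ℓ : ℕ → ℕ} {n : ℕ} {SK VK Sg : Type}

/-- Generating a key pair, signing a message and verifying the resulting signature takes at most
`q` oracle queries in total. -/
def TotalQueriesAtMost (Sch : SignatureScheme ℓ n SK VK Sg) (q : ℕ) : Prop :=
  ∀ (O : Oracle ℓ) (ω : Bits Sch.coins) (α : Bits n),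
    let keys := (Sch.gen ω).eval O
    let σ := (Sch.sign keys.1 α).eval O
    (Sch.gen ω).queries O + (Sch.sign keys.1 α).queries O + (Sch.ver keys.2 α σ).queries O ≤ q

/-- For the oracle `O`, key generation coins `ω` and adversary coins `ρ`: given the verification
key and the signature on `α`, the adversary outputs an accepted signature on a message other
than `α`. -/
def Forges (Sch : SignatureScheme ℓ n SK VK Sg) (α : Bits n) (A : Adversary ℓ n VK Sg)
    (O : Oracle ℓ) (ω : Bits Sch.coins) (ρ : Bits A.coins) : Prop :=
  let keys := (Sch.gen ω).eval O
  let σ := (Sch.sign keys.1 α).eval O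
  let forgery := (A.alg ρ keys.2 σ).eval O
  forgery.1 ≠ α ∧ (Sch.ver keys.2 forgery.1 forgery.2).eval O = true

/-- The probability, over the random oracle and the independent coins of key generation and
adversary, that `A`, given a signature on `α`, produces a forgery. -/
noncomputable def successProb (Sch : SignatureScheme ℓ n SK VK Sg) (α : Bits n)
    (A : Adversary ℓ n VK Sg) : ℝ :=
  ((randomOracle ℓ).prod ((uniformBits Sch.coins).prod (uniformBits A.coins))).real
    {p | Sch.Forges α A p.1 p.2.1 p.2.2}

/-- One-time black-box security `S`. -/
def HasBlackBoxSecurity (Sch : SignatureScheme ℓ n SK VK Sg) (S : ℕ) : Prop :=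
  ∀ (α : Bits n) (T : ℕ), 1 ≤ T → T ≤ S → ∀ A : Adversary ℓ n VK Sg,
    A.MakesAtMost T → Sch.successProb α A ≤ (T : ℝ) / (S : ℝ)

end SignatureScheme

end OneTimeSig

/-! Fix a set `B` of `2 ^ q` messages, which exists because `q ≤ n`. In a fixed world (oracle
answers and coins of key generation) let V(α) be the queries verifying the honest signature on α,
and H(α) the queries of key generation and of signing α that lie outside V(α). These two sets are
disjoint and have at most `q` elements together. If H(α) meets V(β) for all α ≠ β in some family of
messages, Bollobás's set pairs inequality bounds the family by `q.choose (q / 2)`, which is O(2^q /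
√q). So nearly every α in `B` has some β ≠ α in `B` with H(α) ∩ V(β) = ∅ (`World.Vulnerable`), and
averaging gives one α for which this holds in most worlds (`exists_often_vulnerable`).

Given the key and the signature on α, the forger first asks every query lying in the honest run on α
in more than a fraction ε of the consistent worlds. Each such question lowers the expected number of
unknown run queries, initially at most `q`, by at least ε, so a budget of m questions runs out too
early with loss at most q / (ε m) (`exists_learning_strategy`). It then picks a consistent world u
and signs every β in `B` with the secret key of u, using a hybrid oracle: u on the run of u, the
true oracle elsewhere. By completeness each signature verifies under the hybrid oracle, hence also
in reality whenever verification uses no pretended answer outside the known queries. Once no unknown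
query is heavy, V(α) is known, so only H(α) can do harm.

It remains to see that the hybrid oracle looks like a genuine world. Swapping the answers of two
consistent worlds w, u outside the union of their runs is an involution on pairs of consistent
worlds. After the swap the hybrid oracle agrees with the original u except on unknown queries of the
run of w, and these are light, so they rarely hit the at most q 2^q trial queries of u. Thus the
attack succeeds about as often as α is vulnerable (`Consistent.exists_attack`). -/

namespace OneTimeSig

/-! ### Query trees and operations on them -/

namespace OracleComp

variable {ℓ : ℕ → ℕ} {β γ : Type}

/-- Sequential composition. -/
def bind : OracleComp ℓ β → (β → OracleComp ℓ γ) → OracleComp ℓ γ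
  | ret b, k => k b
  | query x next, k => query x fun a => (next a).bind k

@[simp] lemma eval_bind (O : Oracle ℓ) (c : OracleComp ℓ β) (k : β → OracleComp ℓ γ) :
    (c.bind k).eval O = (k (c.eval O)).eval O := by
  induction c with
  | ret b => rfl
  | query x next ih => exact ih _

@[simp] lemma queries_bind (O : Oracle ℓ) (c : OracleComp ℓ β) (k : β → OracleComp ℓ γ) :
    (c.bind k).queries O = c.queries O + (k (c.eval O)).queries O := by
  induction c with
  | ret b => simp [bind, queries, eval]
  | query x next ih => simp only [bind, queries, eval, ih]; omega

/-- The set of queries made when queries are answered by `O`. -/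
def asked (O : Oracle ℓ) : OracleComp ℓ β → Finset (List Bool)
  | ret _ => ∅
  | query x next => insert x ((next (O x)).asked O)

lemma card_asked_le (O : Oracle ℓ) (c : OracleComp ℓ β) : (c.asked O).card ≤ c.queries O := by
  induction c with
  | ret b => simp [asked]
  | query x next ih => exact (Finset.card_insert_le _ _).trans (Nat.succ_le_succ (ih _))

@[simp] lemma asked_bind (O : Oracle ℓ) (c : OracleComp ℓ β) (k : β → OracleComp ℓ γ) :
    (c.bind k).asked O = c.asked O ∪ (k (c.eval O)).asked O := by
  induction c with
  | ret b => simp [bind, asked, eval]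
  | query x next ih => simp only [bind, asked, eval, ih, Finset.insert_union]

lemma eval_congr {O O' : Oracle ℓ} (c : OracleComp ℓ β) (h : ∀ x ∈ c.asked O, O' x = O x) :
    c.eval O' = c.eval O := by
  induction c with
  | ret b => rfl
  | query x next ih =>
    simp only [asked, Finset.mem_insert, forall_eq_or_imp] at h
    simp only [eval, h.1]
    exact ih _ h.2

lemma asked_congr {O O' : Oracle ℓ} (c : OracleComp ℓ β) (h : ∀ x ∈ c.asked O, O' x = O x) :
    c.asked O' = c.asked O := by
  induction c with
  | ret b => rfl
  | query x next ih =>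
    simp only [asked, Finset.mem_insert, forall_eq_or_imp] at h
    simp only [asked, h.1]
    rw [ih _ h.2]

/-- All queries that can be made, over all oracles. -/
def support : OracleComp ℓ β → Finset (List Bool)
  | ret _ => ∅
  | query x next => insert x (Finset.univ.biUnion fun a => (next a).support)

lemma asked_subset_support (O : Oracle ℓ) (c : OracleComp ℓ β) : c.asked O ⊆ c.support := by
  induction c with
  | ret b => exact Finset.Subset.refl _
  | query x next ih =>
    exact Finset.insert_subset_insert _
      ((ih (O x)).trans (Finset.subset_biUnion_of_mem (fun a => (next a).support)
        (Finset.mem_univ (O x))))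

/-- Among oracles that agree on `L`, either a computation stays inside `L`, or all of them share
a query outside `L`. -/
lemma asked_subset_or_common_query {L : Finset (List Bool)} {P : Oracle ℓ} (c : OracleComp ℓ β) :
    c.asked P ⊆ L ∨ ∃ x ∉ L, ∀ O : Oracle ℓ, (∀ y ∈ L, O y = P y) → x ∈ c.asked O := by
  induction c with
  | ret b => exact Or.inl (Finset.empty_subset _)
  | query x next ih =>
    by_cases hx : x ∈ L
    · rcases ih (P x) with h | ⟨y, hy, h⟩
      · exact Or.inl (Finset.insert_subset hx h)
      · refine Or.inr ⟨y, hy, fun O hO => ?_⟩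
        simp only [asked, hO x hx]
        exact Finset.mem_insert_of_mem (h O hO)
    · exact Or.inr ⟨x, hx, fun O _ => Finset.mem_insert_self _ _⟩

end OracleComp

open Classical in
/-- The oracle that answers like `P` on `D` and like `O` elsewhere. -/
noncomputable def mixOracle {ℓ : ℕ → ℕ} (D : Set (List Bool)) (P O : Oracle ℓ) : Oracle ℓ :=
  fun x => if x ∈ D then P x else O x

lemma mixOracle_of_mem {ℓ : ℕ → ℕ} {D : Set (List Bool)} {P O : Oracle ℓ} {x : List Bool}
    (h : x ∈ D) : mixOracle D P O x = P x := if_pos h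

lemma mixOracle_of_notMem {ℓ : ℕ → ℕ} {D : Set (List Bool)} {P O : Oracle ℓ} {x : List Bool}
    (h : x ∉ D) : mixOracle D P O x = O x := if_neg h

namespace OracleComp

variable {ℓ : ℕ → ℕ} {β γ : Type}

open Classical in
/-- Run a computation, answering the queries in `D` according to `P` without asking them. -/
noncomputable def overlay (D : Set (List Bool)) (P : Oracle ℓ) : OracleComp ℓ β → OracleComp ℓ β
  | ret b => ret b
  | query x next =>
    if x ∈ D then (next (P x)).overlay D P else query x fun a => (next a).overlay D P

@[simp] lemma eval_overlay (D : Set (List Bool)) (P O : Oracle ℓ) (c : OracleComp ℓ β) :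
    (c.overlay D P).eval O = c.eval (mixOracle D P O) := by
  induction c with
  | ret b => rfl
  | query x next ih =>
    by_cases hx : x ∈ D
    · simp only [overlay, hx, if_true, eval, ih, mixOracle_of_mem hx]
    · simp only [overlay, hx, if_false, eval, ih, mixOracle_of_notMem hx]

lemma queries_overlay_le (D : Set (List Bool)) (P O : Oracle ℓ) (c : OracleComp ℓ β) :
    (c.overlay D P).queries O ≤ c.queries (mixOracle D P O) := by
  induction c with
  | ret b => exact le_rfl
  | query x next ih =>
    by_cases hx : x ∈ D
    · simp only [overlay, hx, if_true, queries, mixOracle_of_mem hx]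
      exact (ih _).trans (Nat.le_succ _)
    · simp only [overlay, hx, if_false, queries, mixOracle_of_notMem hx]
      exact Nat.succ_le_succ (ih _)

open Classical in
/-- Run a computation, giving up as soon as it is about to make a query in `F`. -/
noncomputable def avoiding (F : Set (List Bool)) : OracleComp ℓ β → OracleComp ℓ (Option β)
  | ret b => ret (some b)
  | query x next => if x ∈ F then ret none else query x fun a => (next a).avoiding F

lemma queries_avoiding_le (F : Set (List Bool)) (O : Oracle ℓ) (c : OracleComp ℓ β) :
    (c.avoiding F).queries O ≤ c.queries O := by
  induction c with
  | ret b => exact le_rfl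
  | query x next ih =>
    by_cases hx : x ∈ F
    · simp only [avoiding, hx, if_true, queries]; omega
    · simp only [avoiding, hx, if_false, queries]
      exact Nat.succ_le_succ (ih _)

lemma isSome_eval_avoiding_iff (F : Set (List Bool)) (O : Oracle ℓ) (c : OracleComp ℓ β) :
    ((c.avoiding F).eval O).isSome = true ↔ ∀ x ∈ c.asked O, x ∉ F := by
  induction c with
  | ret b => simp [avoiding, eval, asked]
  | query x next ih =>
    by_cases hx : x ∈ F
    · simp [avoiding, hx, eval, asked]
    · simp [avoiding, hx, eval, asked, ih]

/-- Run computations one after the other, up to the first that returns a value. -/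
def firstSome : List (OracleComp ℓ (Option β)) → OracleComp ℓ (Option β)
  | [] => ret none
  | c :: cs => c.bind fun
    | some b => ret (some b)
    | none => firstSome cs

lemma queries_firstSome_le (O : Oracle ℓ) (q : ℕ) (cs : List (OracleComp ℓ (Option β)))
    (h : ∀ c ∈ cs, c.queries O ≤ q) : (firstSome cs).queries O ≤ q * cs.length := by
  induction cs with
  | nil => simp [firstSome, queries]
  | cons c cs ih =>
    have h1 := h c List.mem_cons_self
    have h2 := ih fun c hc => h c (List.mem_cons_of_mem _ hc)
    simp only [firstSome, queries_bind, List.length_cons, mul_add, mul_one]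
    cases c.eval O with
    | none => simp only []; omega
    | some b => simp only [queries]; omega

lemma eval_firstSome (O : Oracle ℓ) (cs : List (OracleComp ℓ (Option β)))
    (h : ∃ c ∈ cs, (c.eval O).isSome = true) :
    ∃ c ∈ cs, ∃ b, c.eval O = some b ∧ (firstSome cs).eval O = some b := by
  induction cs with
  | nil => simp at h
  | cons c cs ih =>
    simp only [firstSome, eval_bind]
    cases hc : c.eval O with
    | some b => exact ⟨c, List.mem_cons_self, b, hc, rfl⟩
    | none =>
      obtain ⟨d, hd, hds⟩ := h
      rcases List.mem_cons.mp hd with rfl | hd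
      · simp [hc] at hds
      · obtain ⟨e, he, b, hb, hb'⟩ := ih ⟨d, hd, hds⟩
        exact ⟨e, List.mem_cons_of_mem _ he, b, hb, hb'⟩

end OracleComp

end OneTimeSig

namespace OneTimeSig

/-! ### Bollobás's set pairs inequality -/

section SetPairs

variable {ι κ : Type*} [DecidableEq κ]

/-- Accounts for the points of `B i` when the induction hypothesis of the set pairs inequality is
summed over all deleted points. -/
lemma choose_inv_mul_pred (a b : ℕ) (hb : 0 < b) :
    (b : ℝ) * ((a + (b - 1)).choose a : ℝ)⁻¹ = (a + b : ℝ) * ((a + b).choose a : ℝ)⁻¹ := by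
  obtain ⟨b, rfl⟩ : ∃ c, b = c + 1 := ⟨b - 1, by omega⟩
  have h1 : (0 : ℝ) < ((a + b).choose a : ℝ) := by
    exact_mod_cast Nat.choose_pos (Nat.le_add_right _ _)
  have h2 : (0 : ℝ) < ((a + (b + 1)).choose a : ℝ) := by
    exact_mod_cast Nat.choose_pos (Nat.le_add_right _ _)
  have h3 : ((a + b).choose a : ℝ) * (a + b + 1) = ((a + (b + 1)).choose a : ℝ) * (b + 1) := by
    have := Nat.choose_mul_succ_eq (a + b) a
    rw [show a + b + 1 - a = b + 1 by omega] at this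
    exact_mod_cast this
  simp only [Nat.add_sub_cancel]
  push_cast
  field_simp
  linarith

/-- Bollobás's set pairs inequality. -/
theorem bollobas_set_pairs (X : Finset κ) (s : Finset ι) (A B : ι → Finset κ)
    (hA : ∀ i ∈ s, A i ⊆ X) (hB : ∀ i ∈ s, B i ⊆ X) (hAB : ∀ i ∈ s, Disjoint (A i) (B i))
    (hcross : ∀ i ∈ s, ∀ j ∈ s, i ≠ j → ¬ Disjoint (A i) (B j)) :
    ∑ i ∈ s, (((A i).card + (B i).card).choose (A i).card : ℝ)⁻¹ ≤ 1 := by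
  classical
  induction hn : X.card generalizing X s B with
  | zero =>
    have hX : X = ∅ := Finset.card_eq_zero.mp hn
    subst hX
    have hs : s.card ≤ 1 := by
      refine Finset.card_le_one.mpr fun i hi j hj => ?_
      by_contra hij
      refine hcross i hi j hj hij ?_
      rw [Finset.subset_empty.mp (hA i hi)]
      exact Finset.disjoint_empty_left _
    calc _ ≤ ∑ i ∈ s, (1 : ℝ) := Finset.sum_le_sum fun i hi => by
            rw [Finset.subset_empty.mp (hA i hi), Finset.subset_empty.mp (hB i hi)]; simp
      _ ≤ 1 := by simpa using hs
  | succ N ih =>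
    -- An empty `B i` meets no `A j`, so it forces `s = {i}`. Otherwise every `B i` is nonempty, as
    -- the weight identity requires.
    by_cases hempty : ∃ i ∈ s, B i = ∅
    · obtain ⟨i, hi, hBi⟩ := hempty
      have hs : s = {i} := by
        refine Finset.eq_singleton_iff_unique_mem.mpr ⟨hi, fun j hj => ?_⟩
        by_contra hij
        exact hcross j hj i hi hij (by rw [hBi]; exact Finset.disjoint_empty_right _)
      rw [hs]; simp [hBi]
    push Not at hempty
    -- Delete `x` from the ground set, keeping only the pairs with `x ∉ A i`: crossing survives,
    -- since no remaining intersection uses `x`.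
    have key : ∀ x ∈ X, ∑ i ∈ s with x ∉ A i,
        (((A i).card + ((B i).erase x).card).choose (A i).card : ℝ)⁻¹ ≤ 1 := by
      intro x hx
      refine ih (X.erase x) _ (fun i => (B i).erase x) ?_ ?_ ?_ ?_ ?_
      · intro i hi
        rw [Finset.mem_filter] at hi
        exact Finset.subset_erase.mpr ⟨hA i hi.1, hi.2⟩
      · intro i hi
        exact Finset.erase_subset_erase _ (hB i (Finset.mem_filter.mp hi).1)
      · intro i hi
        exact (hAB i (Finset.mem_filter.mp hi).1).mono_right (Finset.erase_subset _ _)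
      · intro i hi j hj hij hd
        rw [Finset.mem_filter] at hi hj
        refine hcross i hi.1 j hj.1 hij ?_
        rw [Finset.disjoint_left] at hd ⊢
        intro y hy hyB
        exact hd hy (Finset.mem_erase.mpr ⟨fun h => hi.2 (h ▸ hy), hyB⟩)
      · rw [Finset.card_erase_of_mem hx, hn]; rfl
    have hsum : ∑ x ∈ X, ∑ i ∈ s with x ∉ A i,
        (((A i).card + ((B i).erase x).card).choose (A i).card : ℝ)⁻¹ ≤ (N + 1 : ℕ) := by
      calc _ ≤ ∑ x ∈ X, (1 : ℝ) := Finset.sum_le_sum key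
        _ = _ := by simp [hn]
    -- Points outside `A i ∪ B i` leave the weight unchanged, and the `b` points of `B i` contribute
    -- `a + b` times the old weight in total, where `a` and `b` are the two sizes. The sum is always
    -- |X| times the old weight.
    have hinner : ∀ i ∈ s, ∑ x ∈ X with x ∉ A i,
        (((A i).card + ((B i).erase x).card).choose (A i).card : ℝ)⁻¹
        = (N + 1 : ℕ) * (((A i).card + (B i).card).choose (A i).card : ℝ)⁻¹ := by
      intro i hi
      have hsub : B i ⊆ X.filter fun x => x ∉ A i := fun y hy =>
        Finset.mem_filter.mpr ⟨hB i hi hy, fun h => Finset.disjoint_left.mp (hAB i hi) h hy⟩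
      have hcard : (X.filter fun x => x ∉ A i).card = (N + 1) - (A i).card := by
        rw [← Finset.sdiff_eq_filter, Finset.card_sdiff_of_subset (hA i hi), hn]
      have hle := Finset.card_le_card (hA i hi)
      have hle2 := Finset.card_le_card hsub
      rw [← Finset.sum_sdiff hsub]
      have e1 : ∑ x ∈ (X.filter fun x => x ∉ A i) \ B i,
          (((A i).card + ((B i).erase x).card).choose (A i).card : ℝ)⁻¹
          = ((N + 1 : ℕ) - (A i).card - (B i).card : ℝ) *
            (((A i).card + (B i).card).choose (A i).card : ℝ)⁻¹ := by
        rw [Finset.sum_congr rfl (g := fun _ =>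
          (((A i).card + (B i).card).choose (A i).card : ℝ)⁻¹)]
        · rw [Finset.sum_const, Finset.card_sdiff_of_subset hsub, hcard, nsmul_eq_mul,
            Nat.cast_sub (by omega), Nat.cast_sub (by omega)]
        · intro x hx
          rw [Finset.erase_eq_of_notMem (Finset.mem_sdiff.mp hx).2]
      have e2 : ∑ x ∈ B i, (((A i).card + ((B i).erase x).card).choose (A i).card : ℝ)⁻¹
          = ((A i).card + (B i).card : ℝ) *
            (((A i).card + (B i).card).choose (A i).card : ℝ)⁻¹ := by
        rw [← choose_inv_mul_pred _ _
          (Finset.card_pos.mpr (hempty i hi))]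
        rw [Finset.sum_congr rfl (g := fun _ =>
          (((A i).card + ((B i).card - 1)).choose (A i).card : ℝ)⁻¹)]
        · rw [Finset.sum_const, nsmul_eq_mul]
        · intro x hx
          rw [Finset.card_erase_of_mem hx]
      rw [e1, e2]; ring
    have hswap : ∑ x ∈ X, ∑ i ∈ s with x ∉ A i,
        (((A i).card + ((B i).erase x).card).choose (A i).card : ℝ)⁻¹
        = ∑ i ∈ s, ∑ x ∈ X with x ∉ A i,
        (((A i).card + ((B i).erase x).card).choose (A i).card : ℝ)⁻¹ := by
      simp only [Finset.sum_filter]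
      exact Finset.sum_comm
    rw [hswap, Finset.sum_congr rfl hinner, ← Finset.mul_sum] at hsum
    have hpos : (0 : ℝ) < (N + 1 : ℕ) := by positivity
    nlinarith

theorem card_le_choose_of_set_pairs (q : ℕ) (s : Finset ι) (A B : ι → Finset κ)
    (hAB : ∀ i ∈ s, Disjoint (A i) (B i)) (hq : ∀ i ∈ s, (A i).card + (B i).card ≤ q)
    (hcross : ∀ i ∈ s, ∀ j ∈ s, i ≠ j → ¬ Disjoint (A i) (B j)) :
    s.card ≤ q.choose (q / 2) := by
  classical
  have h := bollobas_set_pairs (s.biUnion fun i => A i ∪ B i) s A B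
    (fun i hi => Finset.subset_union_left.trans (Finset.subset_biUnion_of_mem (fun i => A i ∪ B i) hi))
    (fun i hi => Finset.subset_union_right.trans (Finset.subset_biUnion_of_mem (fun i => A i ∪ B i) hi))
    hAB hcross
  have hpos : (0 : ℝ) < (q.choose (q / 2) : ℝ) := by
    exact_mod_cast Nat.choose_pos (Nat.div_le_self _ _)
  have h2 : ∑ i ∈ s, (q.choose (q / 2) : ℝ)⁻¹ ≤ 1 := by
    refine le_trans (Finset.sum_le_sum fun i hi => ?_) h
    refine inv_anti₀ (by exact_mod_cast Nat.choose_pos (Nat.le_add_right _ _)) ?_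
    exact_mod_cast (Nat.choose_le_choose _ (hq i hi)).trans (Nat.choose_le_middle _ _)
  rw [Finset.sum_const, nsmul_eq_mul, ← div_eq_mul_inv, div_le_one hpos] at h2
  exact_mod_cast h2

end SetPairs

/-! ### Size of the middle binomial coefficient -/

section Binomial

lemma centralBinom_sq_le (m : ℕ) : (2 * m + 1) * m.centralBinom ^ 2 ≤ 16 ^ m := by
  induction m with
  | zero => simp
  | succ m ih =>
    have h := Nat.succ_mul_centralBinom_succ m
    have h2 : (m + 1) ^ 2 * ((2 * (m + 1) + 1) * (m + 1).centralBinom ^ 2)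
        ≤ (m + 1) ^ 2 * 16 ^ (m + 1) := by
      calc (m + 1) ^ 2 * ((2 * (m + 1) + 1) * (m + 1).centralBinom ^ 2)
          = (2 * m + 3) * ((m + 1) * (m + 1).centralBinom) ^ 2 := by ring
        _ = 4 * ((2 * m + 3) * (2 * m + 1)) * ((2 * m + 1) * m.centralBinom ^ 2) := by
            rw [h]; ring
        _ ≤ 4 * (4 * (m + 1) ^ 2) * 16 ^ m := by
            refine Nat.mul_le_mul (Nat.mul_le_mul_left _ ?_) ih
            nlinarith
        _ = (m + 1) ^ 2 * 16 ^ (m + 1) := by ring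
    exact Nat.le_of_mul_le_mul_left h2 (by positivity)

lemma two_mul_choose_middle_odd (m : ℕ) :
    2 * (2 * m + 1).choose m = (m + 1).centralBinom := by
  rw [Nat.centralBinom_eq_two_mul_choose, show 2 * (m + 1) = 2 * m + 1 + 1 by ring,
    Nat.choose_succ_succ, Nat.choose_symm_half]
  ring

/-- The largest binomial coefficient `choose q (q / 2)` is `O(2 ^ q / √q)`. -/
lemma choose_middle_sq_le (q : ℕ) : (q + 1) * q.choose (q / 2) ^ 2 ≤ (2 ^ q) ^ 2 := by
  rcases Nat.even_or_odd' q with ⟨m, rfl | rfl⟩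
  · rw [Nat.mul_div_cancel_left _ (by norm_num), ← Nat.centralBinom_eq_two_mul_choose]
    refine (centralBinom_sq_le m).trans (le_of_eq ?_)
    rw [← pow_mul, show 2 * m * 2 = 4 * m by ring, pow_mul]; norm_num
  · rw [show (2 * m + 1) / 2 = m by omega]
    have h1 := centralBinom_sq_le (m + 1)
    rw [← two_mul_choose_middle_odd] at h1
    have e : (2 ^ (2 * m + 1)) ^ 2 * 4 = 16 ^ (m + 1) := by
      rw [← pow_mul, show (16 : ℕ) = 2 ^ 4 by norm_num, ← pow_mul, show (4 : ℕ) = 2 ^ 2 by norm_num,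
        ← pow_add]
      ring_nf
    nlinarith [Nat.zero_le ((2 * m + 1).choose m ^ 2)]

lemma choose_middle_div_le_half {q : ℕ} (hq : 1 ≤ q) :
    (q.choose (q / 2) : ℝ) / 2 ^ q ≤ 1 / 2 := by
  have h : 2 * q.choose (q / 2) ≤ 2 ^ q := by
    rcases Nat.lt_or_ge q 3 with h3 | h3
    · interval_cases q <;> decide
    · have h1 := choose_middle_sq_le q
      refine (Nat.pow_le_pow_iff_left two_ne_zero).mp ?_
      nlinarith [Nat.mul_le_mul_right (q.choose (q / 2) ^ 2) h3]
  rw [div_le_div_iff₀ (by positivity) (by norm_num)]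
  have : ((2 * q.choose (q / 2) : ℕ) : ℝ) ≤ ((2 ^ q : ℕ) : ℝ) := by exact_mod_cast h
  push_cast at this
  linarith

lemma tendsto_choose_middle_div :
    Tendsto (fun q : ℕ => (q.choose (q / 2) : ℝ) / 2 ^ q) atTop (𝓝 0) := by
  have h : Tendsto (fun q : ℕ => Real.sqrt (1 / ((q : ℝ) + 1))) atTop (𝓝 0) := by
    have := (Real.continuous_sqrt.tendsto 0).comp
      (tendsto_one_div_add_atTop_nhds_zero_nat (𝕜 := ℝ))
    simpa [Function.comp_def] using this
  refine squeeze_zero (fun q => by positivity) (fun q => ?_) h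
  apply Real.le_sqrt_of_sq_le
  have h1 : ((q + 1 : ℕ) : ℝ) * (q.choose (q / 2) : ℝ) ^ 2 ≤ ((2 : ℝ) ^ q) ^ 2 := by
    exact_mod_cast choose_middle_sq_le q
  push_cast at h1
  rw [div_pow, div_le_div_iff₀ (by positivity) (by positivity)]
  linarith

end Binomial

end OneTimeSig

namespace OneTimeSig

/-! ### Learning heavy queries -/

section Learning

variable {ℓ : ℕ → ℕ} {Ω γ : Type}

open Classical in
/-- Learning heavy queries. `W` is the set of worlds consistent with what is known, `L` the set of
queries whose answers are known and `D w` the set of hidden queries of the world `w`. If there is a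
good final strategy whenever no unknown query is hidden in more than a fraction `ε` of the worlds,
then asking at most `m` heavy queries first leads to such a situation in most worlds. -/
theorem exists_learning_strategy [Inhabited γ] (orc : Ω → Oracle ℓ) (D : Ω → Finset (List Bool))
    (Good : Ω → Prop) (Succ : Ω → γ → Prop) (Inv : Finset Ω → Finset (List Bool) → Prop)
    (ε δ M : ℝ) (hε : 0 < ε) (hδ : 0 ≤ δ) (hM : 0 < M) (R : ℕ)
    (hInv : ∀ W L, Inv W L → ∀ x a, Inv (W.filter fun w => orc w x = a) (insert x L))
    (hterm : ∀ W L, Inv W L → (∀ x ∉ L, ((W.filter fun w => x ∈ D w).card : ℝ) ≤ ε * W.card) →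
      ∃ c : OracleComp ℓ γ, (∀ O, c.queries O ≤ R) ∧
        ((W.filter fun w => Good w).card : ℝ) - δ * W.card
          ≤ (W.filter fun w => Succ w (c.eval (orc w))).card)
    (m : ℕ) (hm : (m : ℝ) ≤ M) : ∀ W L, Inv W L → ∃ c : OracleComp ℓ γ, (∀ O, c.queries O ≤ m + R) ∧
        ((W.filter fun w => Good w).card : ℝ) - δ * W.card
          - (∑ w ∈ W, ((D w \ L).card : ℝ)) / (ε * M) - W.card * (1 - m / M)
          ≤ (W.filter fun w => Succ w (c.eval (orc w))).card := by
  induction m with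
  | zero =>
    intro W L _
    -- With no budget left the term `W.card * (1 - 0 / M)` already makes the claimed bound
    -- nonpositive.
    refine ⟨.ret default, fun O => Nat.zero_le _, ?_⟩
    have h1 : ((W.filter fun w => Good w).card : ℝ) ≤ W.card := by
      exact_mod_cast Finset.card_filter_le _ _
    have h2 : 0 ≤ δ * W.card := by positivity
    have h3 : 0 ≤ (∑ w ∈ W, ((D w \ L).card : ℝ)) / (ε * M) := by positivity
    have h4 : (0 : ℝ) ≤ ((W.filter fun w =>
      Succ w ((OracleComp.ret default : OracleComp ℓ γ).eval (orc w))).card : ℝ) := by positivity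
    simp only [Nat.cast_zero, zero_div, sub_zero, mul_one]
    linarith
  | succ m ih =>
    intro W L hW
    have ih := ih (by push_cast at hm; linarith)
    by_cases hheavy : ∀ x ∉ L, ((W.filter fun w => x ∈ D w).card : ℝ) ≤ ε * W.card
    · obtain ⟨c, hc, hsucc⟩ := hterm W L hW hheavy
      refine ⟨c, fun O => (hc O).trans (Nat.le_add_left _ _), le_trans ?_ hsucc⟩
      have h3 : 0 ≤ (∑ w ∈ W, ((D w \ L).card : ℝ)) / (ε * M) := by positivity
      have h4 : 0 ≤ (W.card : ℝ) * (1 - ((m + 1 : ℕ) : ℝ) / M) :=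
        mul_nonneg (Nat.cast_nonneg _) (sub_nonneg.mpr ((div_le_one hM).mpr hm))
      linarith
    push Not at hheavy
    obtain ⟨x, hxL, hx⟩ := hheavy
    choose c hcq hc using fun a => ih _ _ (hInv W L hW x a)
    refine ⟨.query x c, fun O => ?_, ?_⟩
    · have := hcq (O x) O
      simp only [OracleComp.queries]; omega
    have hsplit : ∀ f : Ω → ℝ, ∑ w ∈ W, f w
        = ∑ a, ∑ w ∈ W.filter (fun w => orc w x = a), f w := fun f =>
      (Finset.sum_fiberwise W (fun w => orc w x) f).symm
    have hcardsplit : ∀ p : Ω → Prop, ((W.filter p).card : ℝ)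
        = ∑ a, (((W.filter (fun w => orc w x = a)).filter p).card : ℝ) := by
      intro p
      have := hsplit fun w => if p w then 1 else 0
      simpa only [Finset.sum_boole] using this
    have hWsplit : (W.card : ℝ) = ∑ a, ((W.filter (fun w => orc w x = a)).card : ℝ) := by
      simpa using hsplit fun _ => 1
    have hsucc : ((W.filter fun w => Succ w ((OracleComp.query x c).eval (orc w))).card : ℝ)
        = ∑ a, (((W.filter (fun w => orc w x = a)).filter
          fun w => Succ w ((c a).eval (orc w))).card : ℝ) := by
      rw [hcardsplit]
      refine Finset.sum_congr rfl fun a _ => ?_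
      congr 2
      refine Finset.filter_congr fun w hw => ?_
      rw [← (Finset.mem_filter.mp hw).2]; rfl
    -- The potential, the total number of unknown hidden queries, drops by the number of worlds in
    -- which the heavy query `x` is hidden.
    have hpot : ∑ w ∈ W, ((D w \ insert x L).card : ℝ) + ε * W.card
        ≤ ∑ w ∈ W, ((D w \ L).card : ℝ) := by
      have h : ∑ w ∈ W, ((D w \ L).card : ℝ)
          = ∑ w ∈ W, ((D w \ insert x L).card : ℝ) + ((W.filter fun w => x ∈ D w).card : ℝ) := by
        rw [← Finset.sum_boole, ← Finset.sum_add_distrib]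
        refine Finset.sum_congr rfl fun w _ => ?_
        rw [Finset.sdiff_insert]
        by_cases hxD : x ∈ D w
        · rw [if_pos hxD]
          exact_mod_cast (Finset.card_erase_add_one (Finset.mem_sdiff.mpr ⟨hxD, hxL⟩)).symm
        · rw [if_neg hxD, Finset.erase_eq_of_notMem (fun h => hxD (Finset.mem_sdiff.mp h).1)]
          simp
      rw [h]; linarith
    have hsum := Finset.sum_le_sum fun a (_ : a ∈ Finset.univ) => hc a
    rw [hsucc]
    refine le_trans ?_ hsum
    simp only [Finset.sum_sub_distrib, ← Finset.mul_sum, ← Finset.sum_div, ← Finset.sum_mul]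
    rw [← hcardsplit, ← hWsplit, ← hsplit]
    -- The drop in potential pays exactly for the `W.card / M` lost by spending one unit of budget.
    have hdiv : (∑ w ∈ W, ((D w \ insert x L).card : ℝ)) / (ε * M) + W.card / M
        ≤ (∑ w ∈ W, ((D w \ L).card : ℝ)) / (ε * M) := by
      rw [show (W.card : ℝ) / M = ε * W.card / (ε * M) by field_simp, ← add_div]
      gcongr
    have e : (W.card : ℝ) * (1 - ((m + 1 : ℕ) : ℝ) / M)
        = W.card * (1 - m / M) - W.card / M := by
      push_cast; field_simp; ring
    rw [e]; linarith

end Learning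

end OneTimeSig

namespace OneTimeSig

namespace SignatureScheme

variable {ℓ : ℕ → ℕ} {n : ℕ} {SK VK Sg : Type}

/-! ### Queries of the honest run -/

section HonestRun

variable (Sch : SignatureScheme ℓ n SK VK Sg) (O : Oracle ℓ) (ω : Bits Sch.coins) (α : Bits n)

/-- The key pair generated from the oracle `O` and the coins `ω`. -/
def keys : SK × VK := (Sch.gen ω).eval O

/-- The signature on `α` under the generated key. -/
def signature : Sg := (Sch.sign (Sch.keys O ω).1 α).eval O

/-- The queries of key generation. -/
def genQueries : Finset (List Bool) := (Sch.gen ω).asked O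

/-- The queries of signing `α`. -/
def signQueries : Finset (List Bool) := (Sch.sign (Sch.keys O ω).1 α).asked O

/-- The queries of verifying the signature on `α`. -/
def verQueries : Finset (List Bool) :=
  (Sch.ver (Sch.keys O ω).2 α (Sch.signature O ω α)).asked O

/-- All queries of the honest run of the scheme on `α`. -/
def runQueries : Finset (List Bool) :=
  (Sch.genQueries O ω ∪ Sch.signQueries O ω α) ∪ Sch.verQueries O ω α

variable {Sch O ω α}

lemma genQueries_subset_runQueries : Sch.genQueries O ω ⊆ Sch.runQueries O ω α :=
  Finset.subset_union_left.trans Finset.subset_union_left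

lemma signQueries_subset_runQueries : Sch.signQueries O ω α ⊆ Sch.runQueries O ω α :=
  Finset.subset_union_right.trans Finset.subset_union_left

lemma verQueries_subset_runQueries : Sch.verQueries O ω α ⊆ Sch.runQueries O ω α :=
  Finset.subset_union_right

lemma runQueries_eq_asked : Sch.runQueries O ω α =
    ((Sch.gen ω).bind fun k => (Sch.sign k.1 α).bind fun σ => Sch.ver k.2 α σ).asked O := by
  simp only [OracleComp.asked_bind, runQueries, genQueries, signQueries, verQueries, signature,
    keys, Finset.union_assoc]

variable {O' : Oracle ℓ}

lemma keys_congr (h : ∀ x ∈ Sch.genQueries O ω, O' x = O x) : Sch.keys O' ω = Sch.keys O ω :=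
  OracleComp.eval_congr _ h

lemma signature_congr (h : ∀ x ∈ Sch.genQueries O ω, O' x = O x)
    (h' : ∀ x ∈ Sch.signQueries O ω α, O' x = O x) :
    Sch.signature O' ω α = Sch.signature O ω α := by
  rw [signature, keys_congr h]
  exact OracleComp.eval_congr _ h'

lemma verQueries_congr (h : ∀ x ∈ Sch.genQueries O ω, O' x = O x)
    (h' : ∀ x ∈ Sch.signQueries O ω α, O' x = O x)
    (h'' : ∀ x ∈ Sch.verQueries O ω α, O' x = O x) :
    Sch.verQueries O' ω α = Sch.verQueries O ω α := by
  rw [verQueries, keys_congr h, signature_congr h h']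
  exact OracleComp.asked_congr _ h''

lemma runQueries_congr (h : ∀ x ∈ Sch.runQueries O ω α, O' x = O x) :
    Sch.runQueries O' ω α = Sch.runQueries O ω α := by
  rw [runQueries_eq_asked] at h ⊢
  rw [runQueries_eq_asked]
  exact OracleComp.asked_congr _ h

lemma card_queries_le {q : ℕ} (hq : Sch.TotalQueriesAtMost q) :
    (Sch.genQueries O ω).card + (Sch.signQueries O ω α).card + (Sch.verQueries O ω α).card
      ≤ q :=
  (add_le_add (add_le_add (OracleComp.card_asked_le _ _) (OracleComp.card_asked_le _ _))
    (OracleComp.card_asked_le _ _)).trans (hq O ω α)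

lemma card_runQueries_le {q : ℕ} (hq : Sch.TotalQueriesAtMost q) :
    (Sch.runQueries O ω α).card ≤ q := by
  have h1 := card_queries_le (O := O) (ω := ω) (α := α) hq
  have h2 := Finset.card_union_le (Sch.genQueries O ω) (Sch.signQueries O ω α)
  have h3 := Finset.card_union_le (Sch.genQueries O ω ∪ Sch.signQueries O ω α)
    (Sch.verQueries O ω α)
  unfold runQueries
  omega

end HonestRun

/-! ### Finite worlds and the exchange involution -/

/-- A finite set containing the queries of all honest runs. -/
noncomputable def allQueries (Sch : SignatureScheme ℓ n SK VK Sg) : Finset (List Bool) :=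
  (Finset.univ : Finset (Bits Sch.coins × Bits n)).biUnion fun p =>
    ((Sch.gen p.1).bind fun k => (Sch.sign k.1 p.2).bind fun σ => Sch.ver k.2 p.2 σ).support

lemma runQueries_subset_allQueries (Sch : SignatureScheme ℓ n SK VK Sg) (O : Oracle ℓ)
    (ω : Bits Sch.coins) (α : Bits n) : Sch.runQueries O ω α ⊆ Sch.allQueries := by
  rw [runQueries_eq_asked]
  exact (OracleComp.asked_subset_support _ _).trans
    (Finset.subset_biUnion_of_mem (fun p : Bits Sch.coins × Bits n =>
      ((Sch.gen p.1).bind fun k => (Sch.sign k.1 p.2).bind fun σ => Sch.ver k.2 p.2 σ).support)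
      (Finset.mem_univ (ω, α)))

/-- The answers to the relevant queries together with the coins of key generation. -/
abbrev World (Sch : SignatureScheme ℓ n SK VK Sg) : Type :=
  ((x : Sch.allQueries) → Bits (ℓ x.1.length)) × Bits Sch.coins

variable {Sch : SignatureScheme ℓ n SK VK Sg}

/-- The oracle of a world, answering irrelevant queries by zeros. -/
noncomputable def World.oracle (w : Sch.World) : Oracle ℓ :=
  fun x => if h : x ∈ Sch.allQueries then w.1 ⟨x, h⟩ else fun _ => false

/-- The world with coins and answers in `E` taken from `w` and the other answers from `u`. -/
def World.combine (E : Finset (List Bool)) (w u : Sch.World) : Sch.World :=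
  (fun x => if x.1 ∈ E then w.1 x else u.1 x, w.2)

lemma World.oracle_combine (E : Finset (List Bool)) (w u : Sch.World) :
    (World.combine E w u).oracle = mixOracle (E : Set (List Bool)) w.oracle u.oracle := by
  funext x
  by_cases hE : x ∈ E
  · rw [mixOracle_of_mem (by exact_mod_cast hE)]
    simp only [World.oracle, World.combine, hE, if_true]
  · rw [mixOracle_of_notMem (by exact_mod_cast hE)]
    simp only [World.oracle, World.combine, hE, if_false]

/-- The queries of the honest run on `α` in the world `w`. -/
noncomputable def World.run (α : Bits n) (w : Sch.World) : Finset (List Bool) :=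
  Sch.runQueries w.oracle w.2 α

lemma World.run_combine (α : Bits n) (E : Finset (List Bool)) (w u : Sch.World)
    (h : w.run α ⊆ E) : (World.combine E w u).run α = w.run α := by
  unfold World.run
  rw [World.oracle_combine]
  exact runQueries_congr fun x hx => mixOracle_of_mem (by exact_mod_cast h hx)

/-- Exchange the answers of two worlds outside of their honest runs on `α`. -/
noncomputable def World.exchange (α : Bits n) (p : Sch.World × Sch.World) : Sch.World × Sch.World :=
  (World.combine (p.1.run α ∪ p.2.run α) p.1 p.2, World.combine (p.1.run α ∪ p.2.run α) p.2 p.1)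

/-- Both runs survive the exchange, so a second exchange uses the same set of fixed positions and
undoes the first. -/
lemma World.exchange_exchange (α : Bits n) (p : Sch.World × Sch.World) :
    World.exchange α (World.exchange α p) = p := by
  unfold World.exchange
  simp only [World.run_combine α _ _ _ Finset.subset_union_left,
    World.run_combine α _ _ _ Finset.subset_union_right]
  ext x
  · simp only [World.combine]; split_ifs <;> rfl
  · rfl
  · simp only [World.combine]; split_ifs <;> rfl
  · rfl

/-! ### Worlds consistent with the forger's view -/

/-- `W` is the set of worlds consistent with the verification key `vk`, the signature `σ` on `α`
and certain answers to the queries in `L`, up to changes of the answers that matter for none of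
these. -/
structure Consistent (α : Bits n) (vk : VK) (σ : Sg) (W : Finset Sch.World)
    (L : Finset (List Bool)) : Prop where
  view : ∀ w ∈ W, (Sch.keys w.oracle w.2).2 = vk ∧ Sch.signature w.oracle w.2 α = σ
  agree : ∀ w ∈ W, ∀ u ∈ W, ∀ x ∈ L, w.oracle x = u.oracle x
  closed : ∀ w ∈ W, ∀ u : Sch.World, u.2 = w.2 →
    (∀ x ∈ w.run α ∪ L, u.oracle x = w.oracle x) → u ∈ W

namespace Consistent

variable {α : Bits n} {vk : VK} {σ : Sg} {W : Finset Sch.World} {L : Finset (List Bool)}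

open Classical in
lemma filter_view (α : Bits n) (vk : VK) (σ : Sg) : Consistent α vk σ
    (Finset.univ.filter fun w : Sch.World =>
      ((Sch.keys w.oracle w.2).2, Sch.signature w.oracle w.2 α) = (vk, σ)) ∅ where
  view w hw := by simpa using hw
  agree w _ u _ x hx := absurd hx (Finset.notMem_empty x)
  closed w hw u hu h := by
    have hg : ∀ x ∈ Sch.genQueries w.oracle w.2, u.oracle x = w.oracle x := fun x hx =>
      h x (Finset.mem_union_left _ (genQueries_subset_runQueries hx))
    have hs : ∀ x ∈ Sch.signQueries w.oracle w.2 α, u.oracle x = w.oracle x := fun x hx =>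
      h x (Finset.mem_union_left _ (signQueries_subset_runQueries hx))
    simp only [Finset.mem_filter, Finset.mem_univ, true_and] at hw ⊢
    rw [hu, keys_congr hg, signature_congr hg hs, hw]

open Classical in
lemma filter_insert (h : Consistent α vk σ W L) (x : List Bool) (a : Bits (ℓ x.length)) :
    Consistent α vk σ (W.filter fun w => w.oracle x = a) (insert x L) where
  view w hw := h.view w (Finset.mem_filter.mp hw).1
  agree w hw u hu y hy := by
    rw [Finset.mem_filter] at hw hu
    rcases Finset.mem_insert.mp hy with rfl | hy
    · rw [hw.2, hu.2]
    · exact h.agree w hw.1 u hu.1 y hy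
  closed w hw u hu huw := by
    rw [Finset.mem_filter] at hw ⊢
    refine ⟨h.closed w hw.1 u hu fun y hy => huw y ?_, ?_⟩
    · exact Finset.union_subset_union_right (Finset.subset_insert _ _) hy
    · rw [huw x (Finset.mem_union_right _ (Finset.mem_insert_self _ _)), hw.2]

/-- The new answers differ from those of `w` neither on its run nor on `L`, where all consistent
worlds agree, so `closed` applies. -/
lemma combine_mem (h : Consistent α vk σ W L) {w u : Sch.World} (hw : w ∈ W) (hu : u ∈ W)
    {E : Finset (List Bool)} (hE : w.run α ⊆ E) : World.combine E w u ∈ W := by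
  refine h.closed w hw _ rfl fun x hx => ?_
  rw [World.oracle_combine]
  by_cases hxE : x ∈ E
  · exact mixOracle_of_mem (by exact_mod_cast hxE)
  · rw [mixOracle_of_notMem (by exact_mod_cast hxE)]
    rcases Finset.mem_union.mp hx with hx | hx
    · exact absurd (hE hx) hxE
    · exact h.agree u hu w hw x hx

lemma exchange_mem (h : Consistent α vk σ W L) {p : Sch.World × Sch.World} (hp : p ∈ W ×ˢ W) :
    World.exchange α p ∈ W ×ˢ W := by
  rw [Finset.mem_product] at hp ⊢
  exact ⟨h.combine_mem hp.1 hp.2 Finset.subset_union_left,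
    h.combine_mem hp.2 hp.1 Finset.subset_union_right⟩

/-- When no unknown query is common to all consistent honest runs, the queries of the verification
of the given signature are known. -/
lemma verQueries_subset (h : Consistent α vk σ W L) {u : Sch.World} (hu : u ∈ W)
    (hL : ∀ x ∉ L, ∃ w ∈ W, x ∉ w.run α) : Sch.verQueries u.oracle u.2 α ⊆ L := by
  rcases OracleComp.asked_subset_or_common_query (L := L) (P := u.oracle) (Sch.ver vk α σ)
    with hsub | ⟨x, hx, hcommon⟩
  · rwa [verQueries, (h.view u hu).1, (h.view u hu).2]
  · obtain ⟨w, hw, hxw⟩ := hL x hx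
    refine absurd (verQueries_subset_runQueries ?_) hxw
    rw [verQueries, (h.view w hw).1, (h.view w hw).2]
    exact hcommon _ fun y hy => h.agree w hw u hu y hy

end Consistent

/-! ### The attack from a hypothetical world -/

section Attack

variable (α : Bits n) (vk : VK) (σ : Sg) (L : Finset (List Bool)) (u : Sch.World)

/-- Sign `β` with the secret key of the hypothetical world `u`, pretending that the queries of the
honest run on `α` are answered as in `u`, and verify, giving up if the verification depends on
pretended answers. -/
noncomputable def attempt (β : Bits n) : OracleComp ℓ (Option (Bits n × Sg)) :=
  OracleComp.overlay (u.run α : Set (List Bool)) u.oracle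
    ((Sch.sign (Sch.keys u.oracle u.2).1 β).bind fun σ' =>
      (OracleComp.avoiding ((u.run α \ L : Finset (List Bool)) : Set (List Bool))
        (Sch.ver (Sch.keys u.oracle u.2).2 β σ')).bind fun r => .ret (r.map fun _ => (β, σ')))

/-- The attack based on the hypothetical world `u`: try all messages of a finite set. -/
noncomputable def attack (B : Finset (Bits n)) : OracleComp ℓ (Bits n × Sg) :=
  (OracleComp.firstSome ((B.erase α).toList.map (attempt α L u))).bind fun r =>
    .ret (r.getD (α, σ))

/-- The oracle simulated by the attack. -/
noncomputable def World.simulated (O : Oracle ℓ) : Oracle ℓ :=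
  mixOracle (u.run α : Set (List Bool)) u.oracle O

variable {α L u}

lemma keys_simulated (O : Oracle ℓ) :
    Sch.keys (u.simulated α O) u.2 = Sch.keys u.oracle u.2 :=
  keys_congr fun _ hx => mixOracle_of_mem (by exact_mod_cast genQueries_subset_runQueries hx)

lemma eval_attempt (O : Oracle ℓ) (β : Bits n) : (attempt α L u β).eval O =
    ((OracleComp.avoiding ((u.run α \ L : Finset (List Bool)) : Set (List Bool))
      (Sch.ver (Sch.keys (u.simulated α O) u.2).2 β
        (Sch.signature (u.simulated α O) u.2 β))).eval (u.simulated α O)).map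
      fun _ => (β, Sch.signature (u.simulated α O) u.2 β) := by
  rw [attempt, OracleComp.eval_overlay, signature, keys_simulated]
  simp only [OracleComp.eval_bind, OracleComp.eval]
  rfl

lemma isSome_eval_attempt_iff (O : Oracle ℓ) (β : Bits n) :
    ((attempt α L u β).eval O).isSome = true ↔
      ∀ x ∈ Sch.verQueries (u.simulated α O) u.2 β, x ∈ u.run α → x ∈ L := by
  rw [eval_attempt, Option.isSome_map, OracleComp.isSome_eval_avoiding_iff]
  refine forall₂_congr fun x _ => ?_
  simp

/-- An attempt follows part of the honest run on `β` under the simulated oracle, to which the bound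
`q` applies. -/
lemma queries_attempt_le {q : ℕ} (hq : Sch.TotalQueriesAtMost q) (O : Oracle ℓ) (β : Bits n) :
    (attempt α L u β).queries O ≤ q := by
  refine (OracleComp.queries_overlay_le _ _ _ _).trans ?_
  simp only [OracleComp.queries_bind, OracleComp.queries, add_zero]
  have h := hq (u.simulated α O) u.2 β
  have hk : (Sch.gen u.2).eval (u.simulated α O) = Sch.keys u.oracle u.2 := keys_simulated O
  simp only [hk] at h
  refine le_trans ?_ ((add_le_add_left (Nat.le_add_left _ _) _).trans h)
  exact Nat.add_le_add_left (OracleComp.queries_avoiding_le _ _ _) _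

lemma queries_attack_le {q : ℕ} (hq : Sch.TotalQueriesAtMost q) (B : Finset (Bits n))
    (O : Oracle ℓ) : (attack α σ L u B).queries O ≤ q * B.card := by
  simp only [attack, OracleComp.queries_bind, OracleComp.queries, add_zero]
  refine (OracleComp.queries_firstSome_le O q _ fun c hc => ?_).trans ?_
  · obtain ⟨β, _, rfl⟩ := List.mem_map.mp hc
    exact queries_attempt_le hq O β
  · rw [List.length_map, Finset.length_toList]
    exact Nat.mul_le_mul_left _ (Finset.card_le_card (Finset.erase_subset _ _))

/-- A forgery on a message other than `α` whose verification makes only relevant queries. -/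
def World.Forged (α : Bits n) (w : Sch.World) (f : Bits n × Sg) : Prop :=
  f.1 ≠ α ∧ (Sch.ver (Sch.keys w.oracle w.2).2 f.1 f.2).eval w.oracle = true ∧
    (Sch.ver (Sch.keys w.oracle w.2).2 f.1 f.2).asked w.oracle ⊆ Sch.allQueries

variable {vk σ}

/-- The attack may stop at a message other than the promised `β`, but any attempt that does not give
up is sound: its verification uses pretended answers only on `L`, where they are true, so
completeness under the simulated oracle transfers to `w`. -/
lemma Consistent.forged_attack {W : Finset Sch.World} (h : Consistent α vk σ W L) {w : Sch.World}
    (hw : w ∈ W) (hu : u ∈ W) {B : Finset (Bits n)}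
    (hβ : ∃ β ∈ B, β ≠ α ∧
      ∀ x ∈ Sch.verQueries (u.simulated α w.oracle) u.2 β, x ∈ u.run α → x ∈ L) :
    w.Forged α ((attack α σ L u B).eval w.oracle) := by
  obtain ⟨β, hβB, hβα, hβL⟩ := hβ
  obtain ⟨c, hc, b, hcb, hfirst⟩ := OracleComp.eval_firstSome w.oracle
    ((B.erase α).toList.map (attempt α L u))
    ⟨_, List.mem_map_of_mem (Finset.mem_toList.mpr (Finset.mem_erase.mpr ⟨hβα, hβB⟩)),
      (isSome_eval_attempt_iff _ _).mpr hβL⟩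
  obtain ⟨γ, hγ, rfl⟩ := List.mem_map.mp hc
  have hγα := (Finset.mem_erase.mp (Finset.mem_toList.mp hγ)).1
  have hγL := (isSome_eval_attempt_iff w.oracle γ).mp (by rw [hcb]; rfl)
  have hb : b = (γ, Sch.signature (u.simulated α w.oracle) u.2 γ) := by
    rw [eval_attempt] at hcb
    obtain ⟨_, _, h⟩ := Option.map_eq_some_iff.mp hcb
    exact h.symm
  have hres : (attack α σ L u B).eval w.oracle
      = (γ, Sch.signature (u.simulated α w.oracle) u.2 γ) := by
    rw [attack, OracleComp.eval_bind, hfirst, hb]; rfl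
  have hvk : (Sch.keys w.oracle w.2).2 = (Sch.keys (u.simulated α w.oracle) u.2).2 := by
    rw [keys_simulated, (h.view w hw).1, (h.view u hu).1]
  have hagree : ∀ x ∈ Sch.verQueries (u.simulated α w.oracle) u.2 γ,
      w.oracle x = u.simulated α w.oracle x := by
    intro x hx
    by_cases hxu : x ∈ u.run α
    · rw [World.simulated, mixOracle_of_mem (by exact_mod_cast hxu)]
      exact h.agree w hw u hu x (hγL x hx hxu)
    · rw [World.simulated, mixOracle_of_notMem (by exact_mod_cast hxu)]
  rw [hres]
  refine ⟨hγα, ?_, ?_⟩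
  · rw [hvk, OracleComp.eval_congr _ hagree]
    exact Sch.complete _ _ _
  · rw [hvk, OracleComp.asked_congr _ hagree]
    exact verQueries_subset_runQueries.trans (runQueries_subset_allQueries Sch _ _ _)

/-- The honest run on some other message of `B` verifies without touching the unrevealed queries of
key generation and of signing `α`. -/
def World.Vulnerable (α : Bits n) (B : Finset (Bits n)) (w : Sch.World) : Prop :=
  ∃ β ∈ B, β ≠ α ∧
    Disjoint ((Sch.genQueries w.oracle w.2 ∪ Sch.signQueries w.oracle w.2 α) \
      Sch.verQueries w.oracle w.2 α) (Sch.verQueries w.oracle w.2 β)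

/-- The queries of signing the messages of `B` and verifying the signatures. -/
noncomputable def World.trialQueries (B : Finset (Bits n)) (w : Sch.World) : Finset (List Bool) :=
  B.biUnion fun β => Sch.signQueries w.oracle w.2 β ∪ Sch.verQueries w.oracle w.2 β

lemma World.card_trialQueries_le {q : ℕ} (hq : Sch.TotalQueriesAtMost q) (B : Finset (Bits n))
    (w : Sch.World) : (w.trialQueries B).card ≤ q * B.card := by
  rw [mul_comm]
  refine Finset.card_biUnion_le_card_mul _ _ _ fun β _ => ?_
  have h1 := card_queries_le (O := w.oracle) (ω := w.2) (α := β) hq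
  have h2 := Finset.card_union_le (Sch.signQueries w.oracle w.2 β) (Sch.verQueries w.oracle w.2 β)
  omega

lemma Consistent.forged_exchange {W : Finset Sch.World} (h : Consistent α vk σ W L)
    (hL : ∀ x ∉ L, ∃ w ∈ W, x ∉ w.run α) {B : Finset (Bits n)} {p : Sch.World × Sch.World}
    (hp : p ∈ W ×ˢ W) (hv : p.2.Vulnerable α B)
    (hdisj : ∀ x ∈ p.2.trialQueries B \ L, x ∉ p.1.run α) :
    (World.exchange α p).1.Forged α
      ((attack α σ L (World.exchange α p).2 B).eval (World.exchange α p).1.oracle) := by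
  have hp' := Finset.mem_product.mp (h.exchange_mem hp)
  refine h.forged_attack hp'.1 hp'.2 ?_
  obtain ⟨hw, hu⟩ := Finset.mem_product.mp hp
  obtain ⟨β, hβB, hβα, hβ⟩ := hv
  refine ⟨β, hβB, hβα, ?_⟩
  have hrun : (World.exchange α p).2.run α = p.2.run α :=
    World.run_combine α _ _ _ Finset.subset_union_right
  -- After the exchange the first world carries the answers of `p.2` outside both runs, so the
  -- simulated oracle can differ from `p.2.oracle` only on the run of `p.1`.
  have hO : ∀ x, x ∉ p.1.run α \ (p.2.run α ∪ L) →
      (World.exchange α p).2.simulated α (World.exchange α p).1.oracle x = p.2.oracle x := by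
    intro x hx
    by_cases hx2 : x ∈ p.2.run α
    · rw [World.simulated, hrun, mixOracle_of_mem (by exact_mod_cast hx2)]
      simp only [World.exchange, World.oracle_combine]
      exact mixOracle_of_mem (by exact_mod_cast Finset.mem_union_right _ hx2)
    · rw [World.simulated, hrun, mixOracle_of_notMem (by exact_mod_cast hx2)]
      simp only [World.exchange, World.oracle_combine]
      by_cases hx1 : x ∈ p.1.run α
      · rw [mixOracle_of_mem (by exact_mod_cast Finset.mem_union_left _ hx1)]
        have hxL : x ∈ L := by
          by_contra hxL
          exact hx (Finset.mem_sdiff.mpr ⟨hx1, fun h' =>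
            (Finset.mem_union.mp h').elim hx2 hxL⟩)
        exact h.agree _ hw _ hu x hxL
      · refine mixOracle_of_notMem fun h' => ?_
        exact (Finset.mem_union.mp (by exact_mod_cast h')).elim hx1 hx2
  have hgen : ∀ x ∈ Sch.genQueries p.2.oracle p.2.2,
      (World.exchange α p).2.simulated α (World.exchange α p).1.oracle x = p.2.oracle x :=
    fun x hx => hO x fun h' => (Finset.mem_sdiff.mp h').2
      (Finset.mem_union_left _ (genQueries_subset_runQueries hx))
  have htrial : ∀ x ∈ p.2.trialQueries B,
      (World.exchange α p).2.simulated α (World.exchange α p).1.oracle x = p.2.oracle x := by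
    refine fun x hx => hO x fun h' => ?_
    rw [Finset.mem_sdiff] at h'
    exact hdisj x (Finset.mem_sdiff.mpr ⟨hx, fun hxL => h'.2 (Finset.mem_union_right _ hxL)⟩) h'.1
  have hver : Sch.verQueries
      ((World.exchange α p).2.simulated α (World.exchange α p).1.oracle) p.2.2 β
      = Sch.verQueries p.2.oracle p.2.2 β :=
    verQueries_congr hgen
      (fun x hx => htrial x (Finset.mem_biUnion.mpr ⟨β, hβB, Finset.mem_union_left _ hx⟩))
      (fun x hx => htrial x (Finset.mem_biUnion.mpr ⟨β, hβB, Finset.mem_union_right _ hx⟩))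
  intro x hx hxrun
  rw [show (World.exchange α p).2.2 = p.2.2 from rfl, hver] at hx
  rw [hrun] at hxrun
  -- Verification queries on `α` are known, and vulnerability keeps the verification of `β` away
  -- from the rest of the run.
  refine h.verQueries_subset hu hL ?_
  by_contra hxV
  refine Finset.disjoint_left.mp hβ (Finset.mem_sdiff.mpr ⟨?_, hxV⟩) hx
  exact (Finset.mem_union.mp hxrun).resolve_right hxV

open Classical in
/-- When no unknown query is heavy, some hypothetical world gives a good attack. -/
theorem Consistent.exists_attack {W : Finset Sch.World} (h : Consistent α vk σ W L) {q : ℕ}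
    (hq : Sch.TotalQueriesAtMost q) (B : Finset (Bits n)) {ε : ℝ} (hε0 : 0 ≤ ε) (hε1 : ε < 1)
    (hlight : ∀ x ∉ L, ((W.filter fun w => x ∈ w.run α).card : ℝ) ≤ ε * W.card) :
    ∃ c : OracleComp ℓ (Bits n × Sg), (∀ O, c.queries O ≤ q * B.card) ∧
      ((W.filter fun w => w.Vulnerable α B).card : ℝ) - (q * B.card : ℕ) * ε * W.card
        ≤ (W.filter fun w => w.Forged α (c.eval w.oracle)).card := by
  rcases W.eq_empty_or_nonempty with rfl | hne
  · exact ⟨.ret (α, σ), fun O => Nat.zero_le _, by simp⟩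
  have hWpos : (0 : ℝ) < W.card := by exact_mod_cast hne.card_pos
  have hL : ∀ x ∉ L, ∃ w ∈ W, x ∉ w.run α := by
    intro x hx
    by_contra! hall
    have := hlight x hx
    rw [Finset.filter_true_of_mem hall] at this
    nlinarith
  set V := W.filter fun w => w.Vulnerable α B with hV
  have hpairs : ∑ u ∈ V, ((W.filter fun w => ∀ x ∈ u.trialQueries B \ L, x ∉ w.run α).card)
      ≤ ∑ u ∈ W, (W.filter fun w => w.Forged α ((attack α σ L u B).eval w.oracle)).card := by
    have e1 : ∑ u ∈ V, ((W.filter fun w => ∀ x ∈ u.trialQueries B \ L, x ∉ w.run α).card)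
        = ((W ×ˢ W).filter fun p => p.2.Vulnerable α B ∧
          ∀ x ∈ p.2.trialQueries B \ L, x ∉ p.1.run α).card := by
      rw [Finset.card_filter, Finset.sum_product_right, hV, Finset.sum_filter]
      refine Finset.sum_congr rfl fun u _ => ?_
      rw [Finset.card_filter]
      by_cases hu : u.Vulnerable α B <;> simp [hu]
    have e2 : ∑ u ∈ W, (W.filter fun w => w.Forged α ((attack α σ L u B).eval w.oracle)).card
        = ((W ×ˢ W).filter fun p =>
          p.1.Forged α ((attack α σ L p.2 B).eval p.1.oracle)).card := by
      rw [Finset.card_filter, Finset.sum_product_right]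
      exact Finset.sum_congr rfl fun u _ => Finset.card_filter _ _
    rw [e1, e2]
    -- The exchange injects favourable pairs into pairs on which the attack succeeds.
    refine Finset.card_le_card_of_injOn (World.exchange α) (fun p hp => ?_) (fun p _ p' _ hpp => ?_)
    · obtain ⟨hp, hv, hd⟩ := Finset.mem_filter.mp (Finset.mem_coe.mp hp)
      exact Finset.mem_coe.mpr
        (Finset.mem_filter.mpr ⟨h.exchange_mem hp, h.forged_exchange hL hp hv hd⟩)
    · rw [← World.exchange_exchange α p, hpp, World.exchange_exchange]
  have hsingle : ∀ u ∈ V, (W.card : ℝ) - (q * B.card : ℕ) * ε * W.card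
      ≤ ((W.filter fun w => ∀ x ∈ u.trialQueries B \ L, x ∉ w.run α).card : ℝ) := by
    intro u _
    have hcompl : ((W.filter fun w => ¬ ∀ x ∈ u.trialQueries B \ L, x ∉ w.run α).card : ℝ)
        ≤ (q * B.card : ℕ) * ε * W.card := by
      have hsub : (W.filter fun w => ¬ ∀ x ∈ u.trialQueries B \ L, x ∉ w.run α)
          ⊆ (u.trialQueries B \ L).biUnion fun x => W.filter fun w => x ∈ w.run α := by
        intro w hw
        obtain ⟨hwW, hw⟩ := Finset.mem_filter.mp hw
        push Not at hw
        obtain ⟨x, hx, hxw⟩ := hw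
        exact Finset.mem_biUnion.mpr ⟨x, hx, Finset.mem_filter.mpr ⟨hwW, hxw⟩⟩
      calc _ ≤ ((∑ x ∈ u.trialQueries B \ L, (W.filter fun w => x ∈ w.run α).card : ℕ) : ℝ) := by
            exact_mod_cast (Finset.card_le_card hsub).trans Finset.card_biUnion_le
        _ ≤ ∑ x ∈ u.trialQueries B \ L, ε * (W.card : ℝ) := by
            push_cast
            exact Finset.sum_le_sum fun x hx => hlight x (Finset.mem_sdiff.mp hx).2
        _ = (u.trialQueries B \ L).card * (ε * W.card) := by
            rw [Finset.sum_const, nsmul_eq_mul]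
        _ ≤ (q * B.card : ℕ) * (ε * W.card) := by
            refine mul_le_mul_of_nonneg_right ?_ (by positivity)
            exact_mod_cast (Finset.card_le_card Finset.sdiff_subset).trans
              (World.card_trialQueries_le hq B u)
        _ = _ := by ring
    have hadd := Finset.card_filter_add_card_filter_not (s := W)
      (fun w => ∀ x ∈ u.trialQueries B \ L, x ∉ w.run α)
    have hadd' : ((W.filter fun w => ∀ x ∈ u.trialQueries B \ L, x ∉ w.run α).card : ℝ)
        + (W.filter fun w => ¬ ∀ x ∈ u.trialQueries B \ L, x ∉ w.run α).card = W.card := by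
      exact_mod_cast hadd
    linarith
  -- Averaging over `u` derandomizes the choice of the hypothetical world; `V.card ≤ W.card` turns
  -- the product bound into a difference.
  have havg : ∑ u ∈ W, ((V.card : ℝ) - (q * B.card : ℕ) * ε * W.card) ≤
      ∑ u ∈ W, ((W.filter fun w =>
        w.Forged α ((attack α σ L u B).eval w.oracle)).card : ℝ) := by
    have hVW : (V.card : ℝ) ≤ W.card := by exact_mod_cast Finset.card_filter_le _ _
    calc ∑ u ∈ W, ((V.card : ℝ) - (q * B.card : ℕ) * ε * W.card)
        = W.card * (V.card - (q * B.card : ℕ) * ε * W.card) := by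
          rw [Finset.sum_const, nsmul_eq_mul]
      _ ≤ V.card * (W.card - (q * B.card : ℕ) * ε * W.card) := by
          have : 0 ≤ (q * B.card : ℕ) * ε * (W.card : ℝ) := by positivity
          nlinarith
      _ = ∑ u ∈ V, ((W.card : ℝ) - (q * B.card : ℕ) * ε * W.card) := by
          rw [Finset.sum_const, nsmul_eq_mul]
      _ ≤ _ := Finset.sum_le_sum hsingle
      _ ≤ _ := by exact_mod_cast hpairs
  obtain ⟨u, _, hu⟩ := Finset.exists_le_of_sum_le hne havg
  exact ⟨attack α σ L u B, queries_attack_le σ hq B, hu⟩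

end Attack

end SignatureScheme

end OneTimeSig

namespace OneTimeSig

instance (ℓ : ℕ → ℕ) : IsProbabilityMeasure (randomOracle ℓ) := by
  unfold randomOracle; infer_instance

namespace SignatureScheme

variable {ℓ : ℕ → ℕ} {n : ℕ} {SK VK Sg : Type} {Sch : SignatureScheme ℓ n SK VK Sg}

/-! ### From counting worlds to the random oracle -/

section Probability

variable (Sch) in
/-- The world obtained by forgetting the irrelevant answers of an oracle. -/
noncomputable def worldOf (O : Oracle ℓ) (ω : Bits Sch.coins) : Sch.World := (Sch.allQueries.restrict O, ω)

lemma oracle_worldOf {O : Oracle ℓ} {ω : Bits Sch.coins} {x : List Bool}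
    (hx : x ∈ Sch.allQueries) : (Sch.worldOf O ω).oracle x = O x := by
  simp [World.oracle, worldOf, hx]

lemma uniformBits_singleton (k : ℕ) (a : Bits k) :
    uniformBits k {a} = (Fintype.card (Bits k) : ENNReal)⁻¹ := by
  rw [uniformBits, PMF.toMeasure_apply_singleton _ _ (measurableSet_singleton a),
    PMF.uniformOfFintype_apply]

lemma measure_worldOf_preimage_singleton (k : ℕ) (w : Sch.World) :
    ((randomOracle ℓ).prod ((uniformBits Sch.coins).prod (uniformBits k)))
      {p | Sch.worldOf p.1 p.2.1 = w} = (Fintype.card Sch.World : ENNReal)⁻¹ := by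
  have hset : {p : Oracle ℓ × Bits Sch.coins × Bits k | Sch.worldOf p.1 p.2.1 = w}
      = {O | Sch.allQueries.restrict O = w.1} ×ˢ (({w.2} : Set (Bits Sch.coins)) ×ˢ Set.univ) := by
    ext p
    simp [worldOf, Prod.ext_iff]
  have hrestrict : randomOracle ℓ {O | Sch.allQueries.restrict O = w.1}
      = ∏ x : Sch.allQueries, (Fintype.card (Bits (ℓ x.1.length)) : ENNReal)⁻¹ := by
    have hpre : {O : Oracle ℓ | Sch.allQueries.restrict O = w.1}
        = Sch.allQueries.restrict ⁻¹' Set.univ.pi fun x => ({w.1 x} : Set (Bits (ℓ x.1.length))) := by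
      ext O
      simp only [Set.mem_ofPred_eq, Set.mem_preimage, Set.mem_univ_pi, Set.mem_singleton_iff]
      exact funext_iff
    rw [hpre, ← Measure.map_apply (Finset.measurable_restrict _)
      (MeasurableSet.univ_pi fun x => measurableSet_singleton _),
      randomOracle, Measure.infinitePi_map_restrict, Measure.pi_pi]
    exact Finset.prod_congr rfl fun x _ => uniformBits_singleton _ _
  have hcard : (Fintype.card ((x : Sch.allQueries) → Bits (ℓ x.1.length)) : ENNReal)
      = ∏ x : Sch.allQueries, (Fintype.card (Bits (ℓ x.1.length)) : ENNReal) := by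
    rw [Fintype.card_pi, Nat.cast_prod]
  rw [hset, Measure.prod_prod, Measure.prod_prod, measure_univ, mul_one, hrestrict,
    uniformBits_singleton, Fintype.card_prod, Nat.cast_mul, hcard,
    ENNReal.mul_inv (Or.inr (by finiteness)) (Or.inl (ENNReal.prod_ne_top fun _ _ => by finiteness)),
    ENNReal.prod_inv_distrib]
  intro x _ y _ _
  exact Or.inr (by finiteness)

lemma measureReal_worldOf_mem (k : ℕ) (S : Finset Sch.World) :
    ((randomOracle ℓ).prod ((uniformBits Sch.coins).prod (uniformBits k))).real
      {p | Sch.worldOf p.1 p.2.1 ∈ S} = S.card / Fintype.card Sch.World := by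
  have hmeas : Measurable fun p : Oracle ℓ × Bits Sch.coins × Bits k =>
      Sch.worldOf p.1 p.2.1 :=
    ((Finset.measurable_restrict _).comp measurable_fst).prodMk
      (measurable_fst.comp measurable_snd)
  have hset : {p : Oracle ℓ × Bits Sch.coins × Bits k | Sch.worldOf p.1 p.2.1 ∈ S}
      = ⋃ w ∈ S, {p | Sch.worldOf p.1 p.2.1 = w} := by
    ext p; simp
  rw [hset, measureReal_biUnion_finset]
  · simp only [measureReal_def, measure_worldOf_preimage_singleton, Finset.sum_const,
      ENNReal.toReal_inv, ENNReal.toReal_natCast, nsmul_eq_mul, div_eq_mul_inv]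
  · intro w _ w' _ hww'
    refine Set.disjoint_left.mpr fun p hp hp' => hww' ?_
    rw [← show Sch.worldOf p.1 p.2.1 = w from hp, ← show Sch.worldOf p.1 p.2.1 = w' from hp']
  · exact fun w _ => hmeas (measurableSet_singleton w)

variable (Sch) in
/-- The deterministic adversary that follows the strategy `c`, without asking irrelevant queries. -/
noncomputable def adversaryOf (c : VK → Sg → OracleComp ℓ (Bits n × Sg)) :
    Adversary ℓ n VK Sg where
  coins := 0
  alg _ vk σ := (c vk σ).overlay (Sch.allQueries : Set (List Bool))ᶜ fun _ _ => false

lemma adversaryOf_makesAtMost {c : VK → Sg → OracleComp ℓ (Bits n × Sg)} {T : ℕ}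
    (hc : ∀ vk σ O, (c vk σ).queries O ≤ T) : (Sch.adversaryOf c).MakesAtMost T :=
  fun _ _ _ _ => (OracleComp.queries_overlay_le _ _ _ _).trans (hc _ _ _)

-- A forgery in a finite world transfers to every oracle extending it: the honest run and the forged
-- verification make only relevant queries, and the adversary answers irrelevant ones by zeros, just
-- as the world does.
open Classical in
lemma card_forged_div_le_successProb (α : Bits n) (c : VK → Sg → OracleComp ℓ (Bits n × Sg)) :
    ((Finset.univ.filter fun w : Sch.World => w.Forged α
      ((c (Sch.keys w.oracle w.2).2 (Sch.signature w.oracle w.2 α)).eval w.oracle)).card : ℝ)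
      / Fintype.card Sch.World ≤ Sch.successProb α (Sch.adversaryOf c) := by
  rw [← measureReal_worldOf_mem (Sch.adversaryOf c).coins]
  -- Only an inclusion of events is needed, so measurability of the success event plays no role.
  refine measureReal_mono ?_
  rintro ⟨O, ω, ρ⟩ hp
  obtain ⟨hne, hver, hasked⟩ := (Finset.mem_filter.mp hp).2
  set w := Sch.worldOf O ω with hw
  have hO : ∀ x ∈ Sch.allQueries, O x = w.oracle x := fun x hx => (oracle_worldOf hx).symm
  have hmask : mixOracle (Sch.allQueries : Set (List Bool))ᶜ (fun _ _ => false) O = w.oracle := by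
    funext x
    by_cases hx : x ∈ Sch.allQueries
    · rw [mixOracle_of_notMem (by simpa using hx), hO x hx]
    · rw [mixOracle_of_mem (by simpa using hx)]
      simp [World.oracle, hx]
  have hrun : ∀ x ∈ Sch.runQueries w.oracle ω α, O x = w.oracle x := fun x hx =>
    hO x (runQueries_subset_allQueries Sch _ _ _ hx)
  have hgen : ∀ x ∈ Sch.genQueries w.oracle ω, O x = w.oracle x := fun x hx =>
    hrun x (genQueries_subset_runQueries hx)
  have hkeys : Sch.keys O ω = Sch.keys w.oracle ω := keys_congr hgen
  have hsig : Sch.signature O ω α = Sch.signature w.oracle ω α :=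
    signature_congr hgen fun x hx => hrun x (signQueries_subset_runQueries hx)
  have halg : ((Sch.adversaryOf c).alg ρ (Sch.keys O ω).2 (Sch.signature O ω α)).eval O
      = (c (Sch.keys w.oracle ω).2 (Sch.signature w.oracle ω α)).eval w.oracle := by
    rw [hkeys, hsig]
    exact (OracleComp.eval_overlay _ _ _ _).trans (by rw [hmask])
  change (((Sch.adversaryOf c).alg ρ (Sch.keys O ω).2 (Sch.signature O ω α)).eval O).1 ≠ α ∧
    (Sch.ver (Sch.keys O ω).2
      (((Sch.adversaryOf c).alg ρ (Sch.keys O ω).2 (Sch.signature O ω α)).eval O).1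
      (((Sch.adversaryOf c).alg ρ (Sch.keys O ω).2 (Sch.signature O ω α)).eval O).2).eval O = true
  rw [halg, hkeys]
  refine ⟨hne, ?_⟩
  exact (OracleComp.eval_congr _ fun x hx => hO x (hasked hx)).trans hver

end Probability

/-! ### Choice of the message and of the parameters -/

section Strategy

open Classical in
/-- For most worlds in which `α` is vulnerable, learning heavy queries and then attacking
succeeds. -/
theorem exists_strategy {q : ℕ} (hq : Sch.TotalQueriesAtMost q) (α : Bits n) (B : Finset (Bits n))
    {ε : ℝ} (hε0 : 0 < ε) (hε1 : ε < 1) {m : ℕ} (hm : 0 < m) :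
    ∃ c : VK → Sg → OracleComp ℓ (Bits n × Sg),
      (∀ vk σ O, (c vk σ).queries O ≤ m + q * B.card) ∧
      ((Finset.univ.filter fun w : Sch.World => w.Vulnerable α B).card : ℝ)
        - ((q * B.card : ℕ) * ε + q / (ε * m)) * Fintype.card Sch.World
        ≤ ((Finset.univ.filter fun w : Sch.World => w.Forged α
          ((c (Sch.keys w.oracle w.2).2 (Sch.signature w.oracle w.2 α)).eval w.oracle)).card : ℝ)
        := by
  have hm' : (0 : ℝ) < m := by exact_mod_cast hm
  let view : Sch.World → VK × Sg := fun w =>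
    ((Sch.keys w.oracle w.2).2, Sch.signature w.oracle w.2 α)
  have hlearn := fun vk σ => by
    haveI : Inhabited (Bits n × Sg) := ⟨(α, σ)⟩
    exact exists_learning_strategy World.oracle (World.run α) (World.Vulnerable α B)
      (World.Forged α) (Consistent (Sch := Sch) α vk σ) ε ((q * B.card : ℕ) * ε) m hε0
      (by positivity) hm' (q * B.card) (fun W L h x a => h.filter_insert x a)
      (fun W L h hlight => h.exists_attack hq B hε0.le hε1 hlight) m le_rfl _ _
      (Consistent.filter_view α vk σ)
  choose c hcq hc using hlearn
  refine ⟨c, hcq, ?_⟩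
  have hfib : ∀ p : Sch.World → Prop, ((Finset.univ.filter p).card : ℝ)
      = ∑ v ∈ Finset.univ.image view,
        (((Finset.univ.filter fun w => view w = v).filter p).card : ℝ) := by
    intro p
    have := Finset.sum_fiberwise_of_maps_to (s := Finset.univ) (t := Finset.univ.image view)
      (g := view) (fun w hw => Finset.mem_image_of_mem _ hw) fun w => if p w then (1 : ℝ) else 0
    simpa only [Finset.sum_boole] using this.symm
  have hcard : (Fintype.card Sch.World : ℝ) = ∑ v ∈ Finset.univ.image view,
      ((Finset.univ.filter fun w => view w = v).card : ℝ) := by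
    simpa using hfib fun _ => True
  rw [hfib, hfib, hcard, Finset.mul_sum, ← Finset.sum_sub_distrib]
  refine Finset.sum_le_sum fun v _ => ?_
  have h := hc v.1 v.2
  have hforged : ((Finset.univ.filter fun w => view w = v).filter fun w => w.Forged α
        ((c (Sch.keys w.oracle w.2).2 (Sch.signature w.oracle w.2 α)).eval w.oracle))
      = (Finset.univ.filter fun w => view w = v).filter fun w =>
        w.Forged α ((c v.1 v.2).eval w.oracle) := by
    refine Finset.filter_congr fun w hw => ?_
    rw [← (Finset.mem_filter.mp hw).2]
  rw [hforged]
  refine le_trans ?_ h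
  have hpot : ∑ w ∈ Finset.univ.filter (fun w => view w = v), ((w.run α \ ∅).card : ℝ)
      ≤ (Finset.univ.filter fun w => view w = v).card * (q : ℝ) := by
    rw [← nsmul_eq_mul]
    refine Finset.sum_le_card_nsmul _ _ _ fun w _ => ?_
    rw [Finset.sdiff_empty]
    exact_mod_cast card_runQueries_le hq
  have hdiv : (∑ w ∈ Finset.univ.filter (fun w => view w = v), ((w.run α \ ∅).card : ℝ)) / (ε * m)
      ≤ (Finset.univ.filter fun w => view w = v).card * (q : ℝ) / (ε * m) := by
    gcongr
  -- Starting with the full budget makes the last loss term vanish.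
  rw [div_self hm'.ne', sub_self, mul_zero, sub_zero]
  have e : (Finset.univ.filter fun w => view w = v).card * (q : ℝ) / (ε * m)
      = q / (ε * m) * (Finset.univ.filter fun w => view w = v).card := by ring
  rw [e] at hdiv
  change _ ≤ ((Finset.univ.filter fun w => view w = v).filter fun w => w.Vulnerable α B).card -
    (q * B.card : ℕ) * ε * ((Finset.univ.filter fun w => view w = v).card : ℝ) -
    (∑ w ∈ Finset.univ.filter (fun w => view w = v), ((w.run α \ ∅).card : ℝ)) / (ε * m)
  linarith

-- The messages that are not vulnerable form a cross-intersecting family of set pairs.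
open Classical in
lemma card_not_vulnerable_le {q : ℕ} (hq : Sch.TotalQueriesAtMost q) (B : Finset (Bits n))
    (w : Sch.World) : (B.filter fun α => ¬ w.Vulnerable α B).card ≤ q.choose (q / 2) := by
  refine card_le_choose_of_set_pairs q _
    (fun α => (Sch.genQueries w.oracle w.2 ∪ Sch.signQueries w.oracle w.2 α) \
      Sch.verQueries w.oracle w.2 α) (fun α => Sch.verQueries w.oracle w.2 α)
    (fun α _ => Finset.sdiff_disjoint) (fun α _ => ?_) (fun α hα β hβ hαβ hd => ?_)
  · have h1 := card_queries_le (O := w.oracle) (ω := w.2) (α := α) hq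
    have h2 := Finset.card_union_le (Sch.genQueries w.oracle w.2) (Sch.signQueries w.oracle w.2 α)
    have h3 := Finset.card_le_card (Finset.sdiff_subset
      (s := Sch.genQueries w.oracle w.2 ∪ Sch.signQueries w.oracle w.2 α)
      (t := Sch.verQueries w.oracle w.2 α))
    omega
  · exact (Finset.mem_filter.mp hα).2 ⟨β, (Finset.mem_filter.mp hβ).1, hαβ.symm, hd⟩

open Classical in
lemma exists_often_vulnerable {q : ℕ} (hq : Sch.TotalQueriesAtMost q) {B : Finset (Bits n)}
    (hB : B.Nonempty) : ∃ α ∈ B, (1 - (q.choose (q / 2) : ℝ) / B.card) * Fintype.card Sch.World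
      ≤ ((Finset.univ.filter fun w : Sch.World => w.Vulnerable α B).card : ℝ) := by
  have hBpos : (0 : ℝ) < B.card := by exact_mod_cast hB.card_pos
  refine Finset.exists_le_of_sum_le hB ?_
  have hswap : ∑ α ∈ B, ((Finset.univ.filter fun w : Sch.World => w.Vulnerable α B).card : ℝ)
      = ∑ w : Sch.World, ((B.filter fun α => w.Vulnerable α B).card : ℝ) := by
    simp only [← Finset.sum_boole]
    exact Finset.sum_comm
  have hle : ∀ w : Sch.World, (B.card : ℝ) - q.choose (q / 2)
      ≤ ((B.filter fun α => w.Vulnerable α B).card : ℝ) := by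
    intro w
    have h1 : ((B.filter fun α => w.Vulnerable α B).card : ℝ)
        + (B.filter fun α => ¬ w.Vulnerable α B).card = B.card := by
      exact_mod_cast Finset.card_filter_add_card_filter_not (s := B) fun α => w.Vulnerable α B
    have h2 : ((B.filter fun α => ¬ w.Vulnerable α B).card : ℝ) ≤ q.choose (q / 2) := by
      exact_mod_cast card_not_vulnerable_le hq B w
    linarith
  rw [hswap]
  calc _ = ∑ w : Sch.World, ((B.card : ℝ) - q.choose (q / 2)) := by
        rw [Finset.sum_const, Finset.sum_const, nsmul_eq_mul, nsmul_eq_mul, Finset.card_univ]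
        field_simp
    _ ≤ _ := Finset.sum_le_sum fun w _ => hle w

/-- The attack with explicit parameters. -/
theorem exists_adversary {q : ℕ} (hq1 : 1 ≤ q) (hqn : q ≤ n) (hq : Sch.TotalQueriesAtMost q) :
    ∃ (α : Bits n) (A : Adversary ℓ n VK Sg),
      A.MakesAtMost (2 ^ q * (q ^ 2 * (200 + q) ^ 2 + q)) ∧
      1 - ((q.choose (q / 2) : ℝ) / 2 ^ q + 2 / (200 + q)) ≤ Sch.successProb α A := by
  classical
  obtain ⟨B, -, hB⟩ := Finset.exists_subset_card_eq (s := (Finset.univ : Finset (Bits n)))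
    (n := 2 ^ q) (by simpa using Nat.pow_le_pow_right two_pos hqn)
  obtain ⟨α, -, hα⟩ := exists_often_vulnerable (Sch := Sch) hq
    (Finset.card_pos.mp (hB ▸ Nat.two_pow_pos q))
  have hqpos : (0 : ℝ) < q := by exact_mod_cast hq1
  have hA : (0 : ℝ) < 200 + q := by positivity
  have hdenom : (1 : ℝ) < q * 2 ^ q * (200 + q) := by
    have h1 : (1 : ℝ) ≤ q := by exact_mod_cast hq1
    have h2 : (1 : ℝ) ≤ 2 ^ q := one_le_pow₀ one_le_two
    have h3 : (1 : ℝ) ≤ q * 2 ^ q := one_le_mul_of_one_le_of_one_le h1 h2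
    nlinarith
  -- These values make both losses, q 2^q ε from light collisions and q / (ε m) from learning, equal
  -- to 1 / (200 + q).
  obtain ⟨c, hcq, hc⟩ := exists_strategy hq α B (ε := (q * 2 ^ q * (200 + q))⁻¹)
    (by positivity) (inv_lt_one_of_one_lt₀ hdenom)
    (m := q ^ 2 * 2 ^ q * (200 + q) ^ 2) (by positivity)
  refine ⟨α, Sch.adversaryOf c, adversaryOf_makesAtMost fun vk σ O => (hcq vk σ O).trans ?_, ?_⟩
  · rw [hB]
    exact le_of_eq (by ring)
  · refine le_trans ?_ (card_forged_div_le_successProb α c)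
    have hcard : (0 : ℝ) < Fintype.card Sch.World := by exact_mod_cast Fintype.card_pos
    rw [le_div_iff₀ hcard]
    refine le_trans ?_ hc
    have hloss : ((q * B.card : ℕ) : ℝ) * (q * 2 ^ q * (200 + q) : ℝ)⁻¹
        + q / ((q * 2 ^ q * (200 + q) : ℝ)⁻¹ * (q ^ 2 * 2 ^ q * (200 + q) ^ 2 : ℕ))
        = 2 / (200 + q) := by
      rw [hB]
      push_cast
      field_simp
      norm_num
    rw [hloss]
    rw [hB] at hα
    push_cast at hα
    linarith

end Strategy

end SignatureScheme

end OneTimeSig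

namespace OneTimeSig

/-! ### Asymptotics and conclusion -/

lemma tendsto_logb_div : Tendsto (fun q : ℕ => 5 * Real.logb 2 (200 + q) / q) atTop (𝓝 0) := by
  have hshift : Tendsto (fun q : ℕ => (200 : ℝ) + q) atTop atTop :=
    tendsto_atTop_add_const_left _ _ tendsto_natCast_atTop_atTop
  have h1 : Tendsto (fun q : ℕ => Real.log (200 + q) / (200 + q)) atTop (𝓝 0) :=
    (Real.isLittleO_log_id_atTop.tendsto_div_nhds_zero).comp hshift
  have h2 : Tendsto (fun q : ℕ => 200 / (q : ℝ) + 1) atTop (𝓝 (0 + 1)) :=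
    (tendsto_const_div_atTop_nhds_zero_nat 200).add_const 1
  have h3 := (h1.mul h2).const_mul (5 / Real.log 2)
  simp only [zero_mul, mul_zero] at h3
  refine h3.congr' ?_
  filter_upwards [eventually_gt_atTop 0] with q hq
  have hq' : (0 : ℝ) < q := by exact_mod_cast hq
  have hlog : Real.log 2 ≠ 0 := (Real.log_pos one_lt_two).ne'
  have : (200 : ℝ) + q ≠ 0 := by positivity
  rw [Real.logb]
  field_simp

lemma two_rpow_one_add_logb {q : ℕ} (hq : 1 ≤ q) :
    (2 : ℝ) ^ ((1 + 5 * Real.logb 2 (200 + q) / q) * (q : ℝ)) = 2 ^ q * (200 + q) ^ 5 := by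
  have hq' : (0 : ℝ) < q := by exact_mod_cast hq
  have hA : (0 : ℝ) < 200 + q := by positivity
  rw [show (1 + 5 * Real.logb 2 (200 + q) / q) * (q : ℝ)
    = q + Real.logb 2 (200 + q) * (5 : ℕ) by field_simp; push_cast; ring,
    Real.rpow_add two_pos, Real.rpow_natCast, Real.rpow_mul two_pos.le,
    Real.rpow_logb two_pos (by norm_num) hA, Real.rpow_natCast]

end OneTimeSig

theorem mainTheorem2 :
    ∃ ε η : ℕ → ℝ, Tendsto ε atTop (𝓝 0) ∧ Tendsto η atTop (𝓝 0) ∧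
      ∀ (ℓ : ℕ → ℕ) (n q : ℕ), 1 ≤ q → q ≤ n →
        ∀ (SK VK Sg : Type) (Sch : OneTimeSig.SignatureScheme ℓ n SK VK Sg),
          Sch.TotalQueriesAtMost q →
            (∃ (α : OneTimeSig.Bits n) (T : ℕ) (A : OneTimeSig.Adversary ℓ n VK Sg),
              (T : ℝ) ≤ (2 : ℝ) ^ ((1 + ε q) * (q : ℝ)) ∧ A.MakesAtMost T ∧
              1 - η q ≤ Sch.successProb α A ∧ (0.49 : ℝ) ≤ Sch.successProb α A) ∧
            (∀ S : ℕ, Sch.HasBlackBoxSecurity S →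
              (S : ℝ) ≤ (2 : ℝ) ^ ((1 + ε q) * (q : ℝ))) := by
  refine ⟨fun q => 5 * Real.logb 2 (200 + q) / q,
    fun q => (q.choose (q / 2) : ℝ) / 2 ^ q + 2 / (200 + q), OneTimeSig.tendsto_logb_div, ?_, ?_⟩
  · have h : Tendsto (fun q : ℕ => 2 / (200 + (q : ℝ))) atTop (𝓝 0) :=
      tendsto_const_nhds.div_atTop (tendsto_atTop_add_const_left _ _ tendsto_natCast_atTop_atTop)
    simpa using OneTimeSig.tendsto_choose_middle_div.add h
  intro ℓ n q hq1 hqn SK VK Sg Sch hq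
  obtain ⟨α, A, hA, hsucc⟩ := Sch.exists_adversary hq1 hqn hq
  rw [OneTimeSig.two_rpow_one_add_logb hq1]
  set T := 2 ^ q * (q ^ 2 * (200 + q) ^ 2 + q) with hT
  have hT1 : 1 ≤ T := Nat.one_le_iff_ne_zero.mpr (by positivity)
  -- The factor 3 leaves room for the second claim, where `0.49 ≤ T / S` gives `S ≤ 3 * T`.
  have h3T : 3 * (T : ℝ) ≤ 2 ^ q * (200 + q) ^ 5 := by
    have hq' : (1 : ℝ) ≤ q := by exact_mod_cast hq1
    have hpoly : 3 * ((q : ℝ) ^ 2 * (200 + q) ^ 2 + q) ≤ (200 + q) ^ 5 := by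
      have h2 : (q : ℝ) ^ 2 ≤ (200 + q) ^ 2 := by gcongr; linarith
      have h4 : (q : ℝ) ^ 2 * (200 + q) ^ 2 ≤ (200 + q) ^ 4 := by
        calc _ ≤ ((200 : ℝ) + q) ^ 2 * (200 + q) ^ 2 := by gcongr
          _ = _ := by ring
      have h1 : (q : ℝ) ≤ (200 + q) ^ 4 := by
        calc (q : ℝ) ≤ 200 + q := by linarith
          _ ≤ (200 + q) ^ 4 := le_self_pow₀ (by linarith) (by norm_num)
      have h5 : 200 * ((200 : ℝ) + q) ^ 4 ≤ (200 + q) ^ 5 := by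
        rw [pow_succ _ 4, mul_comm]
        gcongr
        linarith
      have : (0 : ℝ) ≤ (200 + q) ^ 4 := by positivity
      linarith
    rw [hT]
    push_cast
    calc _ = 2 ^ q * (3 * ((q : ℝ) ^ 2 * (200 + q) ^ 2 + q)) := by ring
      _ ≤ _ := by gcongr
  have hhalf : (0.49 : ℝ) ≤ Sch.successProb α A := by
    refine le_trans ?_ hsucc
    have h1 := OneTimeSig.choose_middle_div_le_half hq1
    -- The constant 200 keeps this loss at most 0.01, and the binomial loss is at most 1/2, which
    -- leaves 0.49.
    have h2 : 2 / (200 + (q : ℝ)) ≤ 2 / 200 := by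
      gcongr
      linarith [(Nat.cast_nonneg q : (0 : ℝ) ≤ q)]
    norm_num at h1 h2 ⊢
    linarith
  refine ⟨⟨α, T, A, by linarith [(Nat.cast_nonneg T : (0 : ℝ) ≤ T)], hA, hsucc, hhalf⟩, ?_⟩
  intro S hS
  have hT0 : (0 : ℝ) ≤ T := Nat.cast_nonneg T
  -- Security speaks only of `T ≤ S`; if `S < T`, the bound on `T` already suffices.
  rcases lt_or_ge S T with hlt | hge
  · have : (S : ℝ) ≤ T := by exact_mod_cast hlt.le
    linarith
  · have hsec := hhalf.trans (hS α T hT1 hge A hA)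
    have hSpos : (0 : ℝ) < S := by exact_mod_cast hT1.trans hge
    rw [le_div_iff₀ hSpos] at hsec
    norm_num at hsec
    linarith
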